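/- **Setting.** Fix sets of concept names, role names, individual names and variables, and a set $N_{Rs}$ of *simple* roles closed under inverse. A TBox $\mathcal T$ is a finite set of axioms of the forms $A\sqsubseteq A'$, $A\sqsubseteq\exists p$, $\exists p\sqsubseteq A$, $p\sqsubseteq s$, $p\sqsubseteq s^-$, $\mathbf{disj}(A,A')$, $\mathbf{disj}(p,p')$ and complex role inclusions (CRIs) $r\cdot s\sqsubseteq t$ ($A,A'$ concept names; $p,p',r,s,t$ role names), where in every CRI $s$ is simple and $t$ is not, and where $t$ simple and $s\sqsubseteq t\in\mathcal T$ or $s\sqsubseteq t^-\in\mathcal T$ imply $s$ simple. An ABox $\mathcal A$ is a finite set of assertions $A(a)$, $p(a,b)$; $\mathrm{ind}(\mathcal A)$ is the set of its individuals. Interpretations (under the standard name assumption) and models of $(\mathcal T,\mathcal A)$ are as usual; $(\mathcal T,\mathcal A)$ is consistent if it has a model. A conjunctive query (CQ) $q(\vec x)$ is an existentially quantified finite conjunction of atoms $A(x)$, $r(x,y)$ with $x,y$ variables and $t=t'$ with $t,t'$ variables or individuals. For a set $Q$ of CQs of the same arity, read as their union, $cert(Q,\mathcal T,\mathcal A)$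 is the set of tuples $\vec a$ from $\mathrm{ind}(\mathcal A)$ that are an answer of $Q$ in every model of $(\mathcal T,\mathcal A)$; $cert(q,\cdot,\cdot)=cert(\{q\},\cdot,\cdot)$. **Recursion safety.** The recursion graph of $\mathcal T$ has the concept and role names as nodes, an edge from the (concept or role) name on the right-hand side of each inclusion to the one on its left-hand side, and edges from $t$ to $r$ and to $s$ for each CRI $r\cdot s\sqsubseteq t$. Let $\sqsubseteq^{\mathsf s}_{\mathcal T}$ be the reflexive transitive closure of the inclusions of $\mathcal T$ between roles with simple right-hand side (closed under taking inverses on both sides). $\mathcal T$ is *recursion safe* if for each CRI $r_1\cdot s\sqsubseteq r_2\in\mathcal T$: every cycle through $r_2$ has length at most one, and $r_1=r_2$ if there is one; and there is no $A\sqsubseteq\exists t\in\mathcal T$ with $t\sqsubseteq^{\mathsf s}_{\mathcal T}s$ or $t\sqsubseteq^{\mathsf s}_{\mathcal T}s^-$. Let $S_r=\{s\mid r\cdot s\sqsubseteq r\in\mathcal T\}$, and call $r$ *recursive* if $S_r\ne\emptyset$. **Order constraints.** An order constraint $ord(s,\mathbf A,\prec)$ consists of a simple role $s$, a finite set $\mathbf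 A$ of concept names and a strict partial order $\prec$ over $\mathbf A$. It is satisfied in $\mathcal I$ if $s^{\mathcal I}\subseteq\bigcup_{A_1,A_2\in\mathbf A}A_1^{\mathcal I}\times A_2^{\mathcal I}$ and $s^{\mathcal I}\cap\bigcup_{A_1,A_2\in\mathbf A,\,A_1\nprec A_2}A_1^{\mathcal I}\times A_2^{\mathcal I}=\emptyset$. A finite set $\mathcal C$ of order constraints *covers* $\mathcal T$ if for each role name $r$ there are one $\mathbf A$ and one strict partial order $\prec$ over $\mathbf A$ such that $ord(s,\mathbf A,\prec)\in\mathcal C$ for all $s\in S_r$. Put $\ell(\mathcal C)=\max\{|\mathbf A| : ord(s,\mathbf A,\prec)\in\mathcal C\}$ ($0$ if $\mathcal C=\emptyset$). The small model $\mathcal S_{\mathcal T,\mathcal A}$ has as elements the individuals $a$, an element $c_{ar}$ for each individual $a$ and role name $r$, and an element $c_r$ for each role name $r$; concept and role names have the least extensions that satisfy $\mathcal A$, the inclusions of $\mathcal T$ of the forms $A\sqsubseteq A'$, $\exists p\sqsubseteq A$, $p\sqsubseteq s$, $p\sqsubseteq s^-$ and the CRIs of $\mathcal T$, and such that for each $A\sqsubseteq\exists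 r\in\mathcal T$ and each $d$ in $A$, $(d,c_{dr})$ is in $r$ if $d$ is an individual and $(d,c_r)$ is in $r$ otherwise. $(\mathcal T,\mathcal A)$ is *$\mathcal C$-admissible* if $\mathcal S_{\mathcal T,\mathcal A}$ satisfies all of $\mathcal C$. **Rewriting.** For each CQ $q$ fix a variable $z^q$ not occurring in $q$. For a TBox $\mathcal T'$, $rew(q,\mathcal T')$ is the set of CQs obtained from $q$ by finitely many (possibly zero) of the following steps: if $A_1\sqsubseteq A_2\in\mathcal T'$, replace an atom $A_2(x)$ by $A_1(x)$; if $A\sqsubseteq\exists r\in\mathcal T'$ and $y$ is a non-answer variable occurring only once in $q$, replace $r(x,y)$ by $A(x)$; if $\exists r\sqsubseteq A\in\mathcal T'$, replace $A(x)$ by $r(x,z^q)$; if $r\sqsubseteq s\in\mathcal T'$, replace $s(x,y)$ by $r(x,y)$; if $r\sqsubseteq s^-\in\mathcal T'$, replace $s(x,y)$ by $r(y,x)$; if $t\cdot s\sqsubseteq r\in\mathcal T'$, replace $r(x,y)$ by $t(x,z^q),s(z^q,y)$; for $x,y\in vars(q)$, substitute $y$ for $x$ (also in the answer tuple) and drop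 trivial equalities $t=t$. For $k\ge0$ the $k$-unfolding $\mathcal T_k$ of $\mathcal T$ uses, for each recursive $r$, fresh role names $\hat r,r_0,r_1,\dots$ that occur in no ABox. It is obtained from $\mathcal T$ by replacing each $r\cdot s\sqsubseteq r$ with $r\sqsubseteq r_0$, with $r_{j-1}\cdot s\sqsubseteq r_j$ for $1\le j\le k$, and with $r_j\sqsubseteq\hat r$ for $0\le j\le k$, and by adding, for each recursive $r$ and each other role inclusion of $\mathcal T$ with $r$ on the left, the same inclusion with $\hat r$ in place of $r$: $\hat r\sqsubseteq t$ for $r\sqsubseteq t\in\mathcal T$ ($t\neq r$), $\hat r\sqsubseteq t^-$ for $r\sqsubseteq t^-\in\mathcal T$, and $\hat r\cdot s\sqsubseteq t$ for $r\cdot s\sqsubseteq t\in\mathcal T$ ($t\ne r$). The query $\hat q$ is $q$ with $\hat r(x,y)$ for each atom $r(x,y)$ with $r$ recursive. The $k$-rewriting of $q$ w.r.t. $\mathcal T$ is $rew(\hat q,\mathcal T_k)$. **Theorem.** Let $\mathcal T$ be a recursion safe TBox, $\mathcal C$ a finite set of order constraints that covers $\mathcal T$, and $q$ a CQ over names other than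 the fresh ones. Let $q_{\mathcal C}$ be the $\ell(\mathcal C)$-rewriting of $q$ w.r.t. $\mathcal T$. Then, for each ABox $\mathcal A$ such that $(\mathcal T,\mathcal A)$ is consistent and $\mathcal C$-admissible, $$cert(q,\mathcal T,\mathcal A)=cert(q_{\mathcal C},\emptyset,\mathcal A).$$ -/

import Mathlib

namespace DLLite

/-! ### Syntax of DL-Lite with complex role inclusions -/

/-- Roles: a role name `p` or its inverse `p⁻`. -/
inductive Role (NR : Type) : Type
  | name (p : NR)
  | inv (p : NR)

/-- The role name underlying a role. -/
def Role.base {NR : Type} : Role NR → NR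
  | .name p => p
  | .inv p => p

/-- TBox axioms in normal form, together with complex role inclusions (CRIs). -/
inductive TAxiom (NC NR : Type) : Type
  /-- `A ⊑ A'` -/
  | sub (A A' : NC)
  /-- `A ⊑ ∃p` -/
  | subEx (A : NC) (p : NR)
  /-- `∃p ⊑ A` -/
  | exSub (p : NR) (A : NC)
  /-- `p ⊑ s` -/
  | rsub (p s : NR)
  /-- `p ⊑ s⁻` -/
  | rsubInv (p s : NR)
  /-- `disj(A, A')` -/
  | disjC (A A' : NC)
  /-- `disj(p, p')` -/
  | disjR (p p' : NR)
  /-- the CRI `r · s ⊑ t` -/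
  | cri (r s t : NR)

/-- ABox assertions `A(a)` and `p(a,b)`. -/
inductive Assertion (NC NR NI : Type) : Type
  | concept (A : NC) (a : NI)
  | role (p : NR) (a b : NI)

/-- The individuals of an assertion. -/
def Assertion.inds {NC NR NI : Type} : Assertion NC NR NI → Set NI
  | .concept _ a => {a}
  | .role _ a b => {a, b}

/-- `ind(𝒜)`. -/
def ind {NC NR NI : Type} (𝒜 : Set (Assertion NC NR NI)) : Set NI :=
  {a | ∃ α ∈ 𝒜, a ∈ α.inds}

/-! ### Semantics -/

/-- Interpretations.  Under the standard name assumption every individual name is an element of the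
domain, distinct names being distinct elements: `ind` is the inclusion. -/
structure Interp (NC NR NI : Type) where
  dom : Type
  nonempty : Nonempty dom
  ind : NI → dom
  ind_injective : Function.Injective ind
  concept : NC → Set dom
  role : NR → dom → dom → Prop

/-- The interpretation of a possibly inverse role. -/
def Interp.roleExt {NC NR NI : Type} (I : Interp NC NR NI) : Role NR → I.dom → I.dom → Prop
  | .name p => fun d e => I.role p d e
  | .inv p => fun d e => I.role p e d

/-- Satisfaction of a TBox axiom. -/
def Interp.SatAx {NC NR NI : Type} (I : Interp NC NR NI) : TAxiom NC NR → Prop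
  | .sub A A' => ∀ d, d ∈ I.concept A → d ∈ I.concept A'
  | .subEx A p => ∀ d, d ∈ I.concept A → ∃ e, I.role p d e
  | .exSub p A => ∀ d e, I.role p d e → d ∈ I.concept A
  | .rsub p s => ∀ d e, I.role p d e → I.role s d e
  | .rsubInv p s => ∀ d e, I.role p d e → I.role s e d
  | .disjC A A' => ∀ d, ¬ (d ∈ I.concept A ∧ d ∈ I.concept A')
  | .disjR p p' => ∀ d e, ¬ (I.role p d e ∧ I.role p' d e)
  | .cri r s t => ∀ d₁ d₂ d₃, I.role r d₁ d₂ → I.role s d₂ d₃ → I.role t d₁ d₃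

/-- Satisfaction of an assertion. -/
def Interp.SatAssertion {NC NR NI : Type} (I : Interp NC NR NI) : Assertion NC NR NI → Prop
  | .concept A a => I.ind a ∈ I.concept A
  | .role p a b => I.role p (I.ind a) (I.ind b)

/-- `I` is a model of the knowledge base `(T, 𝒜)`. -/
def Interp.IsModel {NC NR NI : Type} (I : Interp NC NR NI) (T : Set (TAxiom NC NR))
    (𝒜 : Set (Assertion NC NR NI)) : Prop :=
  (∀ α ∈ T, I.SatAx α) ∧ (∀ α ∈ 𝒜, I.SatAssertion α)

/-- The knowledge base `(T, 𝒜)` has a model. -/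
def Consistent {NC NR NI : Type} (T : Set (TAxiom NC NR)) (𝒜 : Set (Assertion NC NR NI)) : Prop :=
  ∃ I : Interp NC NR NI, I.IsModel T 𝒜

/-! ### Conjunctive queries and certain answers -/

/-- Terms: variables and individual names. -/
inductive Term (NI V : Type) : Type
  | var (x : V)
  | ind (a : NI)

/-- Query atoms `A(x)`, `r(x,y)` (with variables `x`, `y`) and `t = t'` (with terms `t`, `t'`). -/
inductive Atom (NC NR NI V : Type) : Type
  | concept (A : NC) (x : V)
  | role (r : NR) (x y : V)
  | eq (t t' : Term NI V)

/-- A conjunctive query with `n` answer variables: the tuple of answer variables and the finite set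
of its atoms.  All other variables are existentially quantified. -/
structure CQ (NC NR NI V : Type) (n : ℕ) where
  head : Fin n → V
  atoms : Finset (Atom NC NR NI V)

/-- The variables of a term. -/
def Term.vars {NI V : Type} : Term NI V → Set V
  | .var x => {x}
  | .ind _ => ∅

/-- The variables of an atom. -/
def Atom.vars {NC NR NI V : Type} : Atom NC NR NI V → Set V
  | .concept _ x => {x}
  | .role _ x y => {x, y}
  | .eq t t' => t.vars ∪ t'.vars

/-- `vars(q)`. -/
def CQ.vars {NC NR NI V : Type} {n : ℕ} (q : CQ NC NR NI V n) : Set V :=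
  Set.range q.head ∪ {x | ∃ α ∈ q.atoms, x ∈ α.vars}

/-- The value of a term when `π` assigns values to the variables. -/
def Interp.termVal {NC NR NI V : Type} (I : Interp NC NR NI) (π : V → I.dom) : Term NI V → I.dom
  | .var x => π x
  | .ind a => I.ind a

/-- Satisfaction of an atom under an assignment. -/
def Interp.SatAtom {NC NR NI V : Type} (I : Interp NC NR NI) (π : V → I.dom) :
    Atom NC NR NI V → Prop
  | .concept A x => π x ∈ I.concept A
  | .role r x y => I.role r (π x) (π y)
  | .eq t t' => I.termVal π t = I.termVal π t'

/-- `I ⊨ q(a)`: there is a match of `q` in `I` that sends the answer variables to `a`. -/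
def Interp.IsAnswer {NC NR NI V : Type} {n : ℕ} (I : Interp NC NR NI) (q : CQ NC NR NI V n)
    (a : Fin n → I.dom) : Prop :=
  ∃ π : V → I.dom, (∀ i, π (q.head i) = a i) ∧ ∀ α ∈ q.atoms, I.SatAtom π α

/-- `cert(Q, T, 𝒜)` for a union `Q` of conjunctive queries of arity `n`, given as the set of its
disjuncts; for a single conjunctive query `q` take `Q = {q}`. -/
def cert {NC NR NI V : Type} {n : ℕ} (Q : Set (CQ NC NR NI V n)) (T : Set (TAxiom NC NR))
    (𝒜 : Set (Assertion NC NR NI)) : Set (Fin n → NI) :=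
  {a | (∀ i, a i ∈ ind 𝒜) ∧
    ∀ I : Interp NC NR NI, I.IsModel T 𝒜 → ∃ q ∈ Q, I.IsAnswer q (fun i => I.ind (a i))}

/-! ### Rewriting -/

/-- `q` with the atom `α` replaced by the atoms in `new`. -/
noncomputable def CQ.replace {NC NR NI V : Type} {n : ℕ} (q : CQ NC NR NI V n)
    (α : Atom NC NR NI V) (new : Set (Atom NC NR NI V)) (hnew : new.Finite) :
    CQ NC NR NI V n :=
  open Classical in ⟨q.head, (q.atoms.erase α) ∪ hnew.toFinset⟩

/-- `σ = [x ↦ y]` on variables. -/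
noncomputable def substV {V : Type} (x y v : V) : V :=
  open Classical in if v = x then y else v

/-- Renaming of the variables of a term. -/
def Term.mapV {NI V : Type} (σ : V → V) : Term NI V → Term NI V
  | .var x => .var (σ x)
  | .ind a => .ind a

/-- Renaming of the variables of an atom. -/
def Atom.mapV {NC NR NI V : Type} (σ : V → V) : Atom NC NR NI V → Atom NC NR NI V
  | .concept A x => .concept A (σ x)
  | .role r x y => .role r (σ x) (σ y)
  | .eq t t' => .eq (t.mapV σ) (t'.mapV σ)

/-- The trivial equality atoms `t = t`. -/
def Atom.IsTrivial {NC NR NI V : Type} : Atom NC NR NI V → Prop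
  | .eq t t' => t = t'
  | _ => False

/-- The query obtained from `q` by the substitution `[x ↦ y]`, which acts on the answer variables as
well; the trivial equalities `t = t` are dropped from the result. -/
noncomputable def CQ.subst {NC NR NI V : Type} {n : ℕ} (q : CQ NC NR NI V n) (x y : V) :
    CQ NC NR NI V n :=
  open Classical in
  ⟨fun i => substV x y (q.head i),
    (q.atoms.image (Atom.mapV (substV x y))).filter (fun α => ¬ α.IsTrivial)⟩

/-- `y` is a non-answer variable and the atom `r(x,y)` contains its only occurrence in `q`. -/
def CQ.OccursOnce {NC NR NI V : Type} {n : ℕ} (q : CQ NC NR NI V n) (r : NR) (x y : V) : Prop :=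
  y ∉ Set.range q.head ∧ y ≠ x ∧ ∀ α ∈ q.atoms, α ≠ .role r x y → y ∉ α.vars

/-- One rewriting step; `z q` is the fixed variable `z^q` used as the fresh variable for `q`. -/
inductive Step {NC NR NI V : Type} {n : ℕ} (T : Set (TAxiom NC NR)) (z : CQ NC NR NI V n → V) :
    CQ NC NR NI V n → CQ NC NR NI V n → Prop
  | s1 {q : CQ NC NR NI V n} {A₁ A₂ : NC} {x : V} :
      .sub A₁ A₂ ∈ T → .concept A₂ x ∈ q.atoms →
      Step T z q (q.replace (.concept A₂ x) {.concept A₁ x} (Set.toFinite _))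
  | s2 {q : CQ NC NR NI V n} {A : NC} {r : NR} {x y : V} :
      .subEx A r ∈ T → .role r x y ∈ q.atoms → q.OccursOnce r x y →
      Step T z q (q.replace (.role r x y) {.concept A x} (Set.toFinite _))
  | s3 {q : CQ NC NR NI V n} {A : NC} {r : NR} {x : V} :
      .exSub r A ∈ T → .concept A x ∈ q.atoms →
      Step T z q (q.replace (.concept A x) {.role r x (z q)} (Set.toFinite _))
  | s4 {q : CQ NC NR NI V n} {r s : NR} {x y : V} :
      .rsub r s ∈ T → .role s x y ∈ q.atoms →
      Step T z q (q.replace (.role s x y) {.role r x y} (Set.toFinite _))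
  | s5 {q : CQ NC NR NI V n} {r s : NR} {x y : V} :
      .rsubInv r s ∈ T → .role s x y ∈ q.atoms →
      Step T z q (q.replace (.role s x y) {.role r y x} (Set.toFinite _))
  | s6 {q : CQ NC NR NI V n} {t s r : NR} {x y : V} :
      .cri t s r ∈ T → .role r x y ∈ q.atoms →
      Step T z q (q.replace (.role r x y) {.role t x (z q), .role s (z q) y} (Set.toFinite _))
  | s7 {q : CQ NC NR NI V n} {x y : V} :
      x ∈ q.vars → y ∈ q.vars → Step T z q (q.subst x y)

/-- `rew(q, T)`: all queries reachable from `q` by finitely many rewriting steps. -/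
def rew {NC NR NI V : Type} {n : ℕ} (z : CQ NC NR NI V n → V) (q : CQ NC NR NI V n)
    (T : Set (TAxiom NC NR)) : Set (CQ NC NR NI V n) :=
  {q' | Relation.ReflTransGen (Step T z) q q'}

/-! ### TBoxes with CRIs and recursion safety -/

/-- `T` is a TBox with CRIs, for the set of simple roles `{s, s⁻ | s ∈ simple}`. -/
structure IsTBox {NC NR : Type} (simple : Set NR) (T : Set (TAxiom NC NR)) : Prop where
  finite : T.Finite
  cri_guard : ∀ r s t, .cri r s t ∈ T → s ∈ simple
  cri_head : ∀ r s t, .cri r s t ∈ T → t ∉ simple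
  rsub_simple : ∀ s t, .rsub s t ∈ T → t ∈ simple → s ∈ simple
  rsubInv_simple : ∀ s t, .rsubInv s t ∈ T → t ∈ simple → s ∈ simple

/-- Edges of the recursion graph of `T`; nodes are concept names (`inl`) and role names (`inr`). -/
inductive Edge {NC NR : Type} (T : Set (TAxiom NC NR)) : NC ⊕ NR → NC ⊕ NR → Prop
  | sub {A₁ A₂ : NC} : .sub A₁ A₂ ∈ T → Edge T (.inl A₂) (.inl A₁)
  | rsub {t r : NR} : .rsub t r ∈ T → Edge T (.inr r) (.inr t)
  | rsubInv {r p : NR} : .rsubInv r p ∈ T → Edge T (.inr p) (.inr r)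
  | subEx {A : NC} {r : NR} : .subEx A r ∈ T → Edge T (.inr r) (.inl A)
  | exSub {r : NR} {A : NC} : .exSub r A ∈ T → Edge T (.inl A) (.inr r)
  | criL {r s t : NR} : .cri r s t ∈ T → Edge T (.inr t) (.inr r)
  | criR {r s t : NR} : .cri r s t ∈ T → Edge T (.inr t) (.inr s)

/-- One simple inclusion between roles.  An axiom `s₁ ⊑ s₂` also includes `s₁⁻` in `s₂⁻`, and
`s₁ ⊑ s₂⁻` also includes `s₁⁻` in `s₂`. -/
inductive SimpleStep {NC NR : Type} (simple : Set NR) (T : Set (TAxiom NC NR)) :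
    Role NR → Role NR → Prop
  | rsub {p s : NR} : .rsub p s ∈ T → s ∈ simple → SimpleStep simple T (.name p) (.name s)
  | rsub' {p s : NR} : .rsub p s ∈ T → s ∈ simple → SimpleStep simple T (.inv p) (.inv s)
  | rsubInv {p s : NR} : .rsubInv p s ∈ T → s ∈ simple → SimpleStep simple T (.name p) (.inv s)
  | rsubInv' {p s : NR} : .rsubInv p s ∈ T → s ∈ simple → SimpleStep simple T (.inv p) (.name s)

/-- The reflexive and transitive closure of the simple inclusions of `T`. -/
def SimpleIncl {NC NR : Type} (simple : Set NR) (T : Set (TAxiom NC NR)) :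
    Role NR → Role NR → Prop :=
  Relation.ReflTransGen (SimpleStep simple T)

/-- Recursion safety.  Every cycle of the recursion graph through `r₂` has length at most one iff no
node other than `r₂` is both reachable from `r₂` and has `r₂` reachable from it. -/
structure RecursionSafe {NC NR : Type} (simple : Set NR) (T : Set (TAxiom NC NR)) : Prop where
  cycle_length : ∀ r₁ s r₂, .cri r₁ s r₂ ∈ T → ∀ v : NC ⊕ NR,
    Relation.TransGen (Edge T) (.inr r₂) v → Relation.TransGen (Edge T) v (.inr r₂) → v = .inr r₂
  cycle_cri : ∀ r₁ s r₂, .cri r₁ s r₂ ∈ T →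
    Relation.TransGen (Edge T) (.inr r₂) (.inr r₂) → r₁ = r₂
  guard : ∀ r₁ s r₂, .cri r₁ s r₂ ∈ T → ∀ A t, .subEx A t ∈ T →
    ¬ SimpleIncl simple T (.name t) (.name s) ∧ ¬ SimpleIncl simple T (.name t) (.inv s)

/-- `S_r = {s | r · s ⊑ r ∈ T}`. -/
def guards {NC NR : Type} (T : Set (TAxiom NC NR)) (r : NR) : Set NR :=
  {s | .cri r s r ∈ T}

/-- `r` is a role with a recursive CRI.  (In a recursion-safe TBox the recursive CRIs are exactly
those of the form `r · s ⊑ r`.) -/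
def HasRecursiveCRI {NC NR : Type} (T : Set (TAxiom NC NR)) (r : NR) : Prop :=
  (guards T r).Nonempty

/-! ### The small model -/

/-- Elements of the small model: individuals `a`, witnesses `c_{ar}` and shared witnesses `c_r`. -/
inductive SElem (NR NI : Type) : Type
  | ind (a : NI)
  | wit (a : NI) (r : NR)
  | shared (r : NR)

/-- Facts over a domain `D`. -/
inductive Fact (NC NR D : Type) : Type
  | concept (A : NC) (d : D)
  | role (r : NR) (d e : D)

/-- The facts of the small model: the least set closed under its defining conditions. -/
inductive SFact {NC NR NI : Type} (T : Set (TAxiom NC NR)) (𝒜 : Set (Assertion NC NR NI)) :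
    Fact NC NR (SElem NR NI) → Prop
  | concept {A : NC} {a : NI} : .concept A a ∈ 𝒜 → SFact T 𝒜 (.concept A (.ind a))
  | role {r : NR} {a b : NI} : .role r a b ∈ 𝒜 → SFact T 𝒜 (.role r (.ind a) (.ind b))
  | subEx_ind {A : NC} {r : NR} {a : NI} : .subEx A r ∈ T → SFact T 𝒜 (.concept A (.ind a)) →
      SFact T 𝒜 (.role r (.ind a) (.wit a r))
  | subEx_wit {A : NC} {r : NR} {a : NI} {p : NR} : .subEx A r ∈ T →
      SFact T 𝒜 (.concept A (.wit a p)) → SFact T 𝒜 (.role r (.wit a p) (.shared r))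
  | subEx_shared {A : NC} {r p : NR} : .subEx A r ∈ T →
      SFact T 𝒜 (.concept A (.shared p)) → SFact T 𝒜 (.role r (.shared p) (.shared r))
  | sub {A A' : NC} {d : SElem NR NI} : .sub A A' ∈ T → SFact T 𝒜 (.concept A d) →
      SFact T 𝒜 (.concept A' d)
  | exSub {p : NR} {A : NC} {d e : SElem NR NI} : .exSub p A ∈ T → SFact T 𝒜 (.role p d e) →
      SFact T 𝒜 (.concept A d)
  | rsub {p s : NR} {d e : SElem NR NI} : .rsub p s ∈ T → SFact T 𝒜 (.role p d e) →
      SFact T 𝒜 (.role s d e)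
  | rsubInv {p s : NR} {d e : SElem NR NI} : .rsubInv p s ∈ T → SFact T 𝒜 (.role p d e) →
      SFact T 𝒜 (.role s e d)
  | cri {r s t : NR} {d e f : SElem NR NI} : .cri r s t ∈ T → SFact T 𝒜 (.role r d e) →
      SFact T 𝒜 (.role s e f) → SFact T 𝒜 (.role t d f)

/-- The small model of `(T, 𝒜)`.  Its domain is enlarged by elements that belong to no concept and
no role (for instance the individuals outside `ind(𝒜)`), so that it interprets every individual
name; this has no influence on the order constraints that it satisfies. -/
def smallModel {NC NR NI : Type} [Nonempty NI] (T : Set (TAxiom NC NR))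
    (𝒜 : Set (Assertion NC NR NI)) : Interp NC NR NI where
  dom := SElem NR NI
  nonempty := ⟨.ind (Classical.arbitrary NI)⟩
  ind := .ind
  ind_injective := fun _ _ h => by injection h
  concept := fun A => {d | SFact T 𝒜 (.concept A d)}
  role := fun r d e => SFact T 𝒜 (.role r d e)

/-! ### Order constraints -/

/-- Order constraints `ord(s, 𝐀, ≺)`: `s` is a simple role, `𝐀` a finite set of concept names and
`≺` a strict partial order over `𝐀`. -/
structure OrdConstraint (NC : Type) {NR : Type} (simple : Set NR) where
  role : Role NR
  role_simple : role.base ∈ simple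
  concepts : Finset NC
  lt : NC → NC → Prop
  lt_mem : ∀ A B, lt A B → A ∈ concepts ∧ B ∈ concepts
  lt_irrefl : ∀ A, ¬ lt A A
  lt_trans : ∀ A B D, lt A B → lt B D → lt A D

/-- `I` satisfies `ord(s, 𝐀, ≺)`. -/
def Interp.SatOrd {NC NR NI : Type} {simple : Set NR} (I : Interp NC NR NI)
    (c : OrdConstraint NC simple) : Prop :=
  (∀ d e, I.roleExt c.role d e →
    ∃ A₁ ∈ c.concepts, ∃ A₂ ∈ c.concepts, d ∈ I.concept A₁ ∧ e ∈ I.concept A₂) ∧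
  (∀ d e, I.roleExt c.role d e →
    ¬ ∃ A₁ ∈ c.concepts, ∃ A₂ ∈ c.concepts,
      ¬ c.lt A₁ A₂ ∧ d ∈ I.concept A₁ ∧ e ∈ I.concept A₂)

/-- `C` covers `T`: for each `S_r` there are one set `𝐀` of concept names and one strict partial
order `≺` over `𝐀` with `ord(s, 𝐀, ≺) ∈ C` for all `s ∈ S_r`. -/
def Covers {NC NR : Type} {simple : Set NR} (C : Finset (OrdConstraint NC simple))
    (T : Set (TAxiom NC NR)) : Prop :=
  ∀ r : NR, ∃ (As : Finset NC) (lt : NC → NC → Prop), ∀ s ∈ guards T r,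
    ∃ c ∈ C, c.role = .name s ∧ c.concepts = As ∧ c.lt = lt

/-- `(T, 𝒜)` is `C`-admissible: the small model satisfies `C`. -/
def Admissible {NC NR NI : Type} [Nonempty NI] {simple : Set NR}
    (C : Finset (OrdConstraint NC simple)) (T : Set (TAxiom NC NR))
    (𝒜 : Set (Assertion NC NR NI)) : Prop :=
  ∀ c ∈ C, (smallModel T 𝒜).SatOrd c

/-- `ℓ(C) = max {|𝐀| : ord(s, 𝐀, ≺) ∈ C}`, which is `0` for empty `C`. -/
def ell {NC NR : Type} {simple : Set NR} (C : Finset (OrdConstraint NC simple)) : ℕ :=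
  C.sup fun c => c.concepts.card

/-! ### Unfolding -/

/-- The role names extended by the fresh names `r_j` (`level r j`) and `r̂` (`hat r`). -/
inductive XRole (NR : Type) : Type
  | base (r : NR)
  | level (r : NR) (j : ℕ)
  | hat (r : NR)

/-- Renaming of the roles in an axiom. -/
def TAxiom.mapR {NC NR NR' : Type} (f : NR → NR') : TAxiom NC NR → TAxiom NC NR'
  | .sub A A' => .sub A A'
  | .subEx A p => .subEx A (f p)
  | .exSub p A => .exSub (f p) A
  | .rsub p s => .rsub (f p) (f s)
  | .rsubInv p s => .rsubInv (f p) (f s)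
  | .disjC A A' => .disjC A A'
  | .disjR p p' => .disjR (f p) (f p')
  | .cri r s t => .cri (f r) (f s) (f t)

/-- Renaming of the roles in an assertion. -/
def Assertion.mapR {NC NR NR' NI : Type} (f : NR → NR') :
    Assertion NC NR NI → Assertion NC NR' NI
  | .concept A a => .concept A a
  | .role p a b => .role (f p) a b

/-- Renaming of the roles in a query atom. -/
def Atom.mapR {NC NR NR' NI V : Type} (f : NR → NR') : Atom NC NR NI V → Atom NC NR' NI V
  | .concept A x => .concept A x
  | .role r x y => .role (f r) x y
  | .eq t t' => .eq t t'

/-- The ABox `𝒜`, read over the extended role names (the fresh names do not occur in it). -/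
def liftABox {NC NR NI : Type} (𝒜 : Set (Assertion NC NR NI)) : Set (Assertion NC (XRole NR) NI) :=
  Assertion.mapR XRole.base '' 𝒜

/-- The `k`-unfolding of `T`.  Each `r · s ⊑ r` is replaced by `r ⊑ r_0`, by `r_{j-1} · s ⊑ r_j` for
`1 ≤ j ≤ k`, and by `r_j ⊑ r̂` for `0 ≤ j ≤ k`; all other axioms are kept.  As the unfolding derives
the recursive consequences for `r` only as facts about `r̂`, the other role inclusions that have `r`
on the left are also added with `r̂` in place of `r`. -/
inductive Unfolding {NC NR : Type} (T : Set (TAxiom NC NR)) (k : ℕ) : TAxiom NC (XRole NR) → Prop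
  | keep {α : TAxiom NC NR} : α ∈ T → (∀ r s, α ≠ .cri r s r) → Unfolding T k (α.mapR XRole.base)
  | start {r s : NR} : .cri r s r ∈ T → Unfolding T k (.rsub (.base r) (.level r 0))
  | next {r s : NR} {j : ℕ} : .cri r s r ∈ T → j + 1 ≤ k →
      Unfolding T k (.cri (.level r j) (.base s) (.level r (j + 1)))
  | finish {r s : NR} {j : ℕ} : .cri r s r ∈ T → j ≤ k → Unfolding T k (.rsub (.level r j) (.hat r))
  | rsub_hat {r t : NR} : HasRecursiveCRI T r → .rsub r t ∈ T → t ≠ r →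
      Unfolding T k (.rsub (.hat r) (.base t))
  | rsubInv_hat {r t : NR} : HasRecursiveCRI T r → .rsubInv r t ∈ T →
      Unfolding T k (.rsubInv (.hat r) (.base t))
  | cri_hat {r s t : NR} : HasRecursiveCRI T r → .cri r s t ∈ T → t ≠ r →
      Unfolding T k (.cri (.hat r) (.base s) (.base t))

/-- `r ↦ r̂` for the roles with a recursive CRI; all other roles are unchanged. -/
noncomputable def hatRole {NC NR : Type} (T : Set (TAxiom NC NR)) (r : NR) : XRole NR :=
  open Classical in if HasRecursiveCRI T r then .hat r else .base r

/-- The query `q̂`. -/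
noncomputable def hatQuery {NC NR NI V : Type} {n : ℕ} (T : Set (TAxiom NC NR))
    (q : CQ NC NR NI V n) : CQ NC (XRole NR) NI V n :=
  open Classical in ⟨q.head, q.atoms.image (Atom.mapR (hatRole T))⟩

/-- The `k`-rewriting of `q` with respect to `T`. -/
noncomputable def kRewriting {NC NR NI V : Type} {n : ℕ} (z : CQ NC (XRole NR) NI V n → V)
    (T : Set (TAxiom NC NR)) (k : ℕ) (q : CQ NC NR NI V n) : Set (CQ NC (XRole NR) NI V n) :=
  rew z (hatQuery T q) {α | Unfolding T k α}

end DLLite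

namespace DLLite

/-! Write `k` for `ell C` and `T_k` for the `k`-unfolding.

A rewritten query never yields too much. A model of `(T, 𝒜)` interprets `r`, `r_j` and `r̂` alike as
`r` (`Interp.extend`) and then satisfies all positive axioms of `T_k`. Each rewriting step is sound
under those axioms (`Step.isAnswer`), so an answer of a disjunct is an answer of `q̂`, hence of `q`.

Conversely, a certain answer of `q` is tested in one particular model: the Skolem chase of `T_k`
over `𝒜`, with each recursive `r` read as `r̂` (`unfoldingModel_isModel`). The delicate axiom is `r
· s ⊑ r`, because `T_k` stops counting at level `k`. Here admissibility enters
(`InUnfoldingChase.level_le`). The chase maps homomorphically into the small model, and a fact at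
level `j` followed by an `s`-edge becomes a path of `j + 1` edges with roles in `S_r`. By the order
constraints the labels along this path increase strictly in one order on at most `k` concept names.
Hence `j + 1 ≤ k`, and the composition is still recorded.

The certain answer is thus a match of `q̂` in a chase. Rewriting undoes chase steps
(`CQ.Matches.exists_mem_rew`): as long as the match uses a derived fact, some step replaces it by
its premises and lowers the total size of the derivations. At the end a disjunct matches the ABox
itself, and ABox facts hold in every model. -/

/-! ### The Skolem chase -/

/-- Elements of the chase: individuals, and a witness for each element and each role name. -/
inductive SkolemTerm (NR NI : Type) : Type
  | ind (a : NI)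
  | null (d : SkolemTerm NR NI) (r : NR)

/-- The nesting depth of a chase element. -/
def SkolemTerm.depth {NR NI : Type} : SkolemTerm NR NI → ℕ
  | .ind _ => 0
  | .null d _ => d.depth + 1

/-- `Derives T 𝒜 n f`: the fact `f` of the Skolem chase has a derivation with `n` rule
applications. -/
inductive Derives {NC NR NI : Type} (T : Set (TAxiom NC NR)) (𝒜 : Set (Assertion NC NR NI)) :
    ℕ → Fact NC NR (SkolemTerm NR NI) → Prop
  | concept {A : NC} {a : NI} : .concept A a ∈ 𝒜 → Derives T 𝒜 0 (.concept A (.ind a))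
  | role {r : NR} {a b : NI} : .role r a b ∈ 𝒜 → Derives T 𝒜 0 (.role r (.ind a) (.ind b))
  | subEx {A : NC} {r : NR} {d : SkolemTerm NR NI} {n : ℕ} : .subEx A r ∈ T →
      Derives T 𝒜 n (.concept A d) → Derives T 𝒜 (n + 1) (.role r d (.null d r))
  | sub {A A' : NC} {d : SkolemTerm NR NI} {n : ℕ} : .sub A A' ∈ T →
      Derives T 𝒜 n (.concept A d) → Derives T 𝒜 (n + 1) (.concept A' d)
  | exSub {p : NR} {A : NC} {d e : SkolemTerm NR NI} {n : ℕ} : .exSub p A ∈ T →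
      Derives T 𝒜 n (.role p d e) → Derives T 𝒜 (n + 1) (.concept A d)
  | rsub {p s : NR} {d e : SkolemTerm NR NI} {n : ℕ} : .rsub p s ∈ T →
      Derives T 𝒜 n (.role p d e) → Derives T 𝒜 (n + 1) (.role s d e)
  | rsubInv {p s : NR} {d e : SkolemTerm NR NI} {n : ℕ} : .rsubInv p s ∈ T →
      Derives T 𝒜 n (.role p d e) → Derives T 𝒜 (n + 1) (.role s e d)
  | cri {r s t : NR} {d e f : SkolemTerm NR NI} {m n : ℕ} : .cri r s t ∈ T →
      Derives T 𝒜 m (.role r d e) → Derives T 𝒜 n (.role s e f) →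
      Derives T 𝒜 (m + n + 1) (.role t d f)

/-- The facts of the Skolem chase. -/
def InChase {NC NR NI : Type} (T : Set (TAxiom NC NR)) (𝒜 : Set (Assertion NC NR NI))
    (f : Fact NC NR (SkolemTerm NR NI)) : Prop :=
  ∃ n, Derives T 𝒜 n f

/-- The Skolem chase as an interpretation. -/
def chase {NC NR NI : Type} [Nonempty NI] (T : Set (TAxiom NC NR))
    (𝒜 : Set (Assertion NC NR NI)) : Interp NC NR NI where
  dom := SkolemTerm NR NI
  nonempty := ⟨.ind (Classical.arbitrary NI)⟩
  ind := .ind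
  ind_injective := fun _ _ h => by injection h
  concept := fun A => {d | InChase T 𝒜 (.concept A d)}
  role := fun r d e => InChase T 𝒜 (.role r d e)

/-- The ABox as an interpretation over the individuals. -/
def aboxInterp {NC NR NI : Type} [Nonempty NI] (𝒜 : Set (Assertion NC NR NI)) :
    Interp NC NR NI where
  dom := NI
  nonempty := inferInstance
  ind := id
  ind_injective := Function.injective_id
  concept := fun A => {a | .concept A a ∈ 𝒜}
  role := fun r a b => .role r a b ∈ 𝒜

/-- The axioms that are not disjointness axioms. -/
def TAxiom.IsPositive {NC NR : Type} : TAxiom NC NR → Prop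
  | .disjC _ _ => False
  | .disjR _ _ => False
  | _ => True

/-! ### Homomorphisms out of the chase, and the small model as a target -/

section Hom

variable {NC NR NI : Type} {T : Set (TAxiom NC NR)} {𝒜 : Set (Assertion NC NR NI)}

/-- The homomorphism from the chase into an interpretation, by recursion on the depth. -/
noncomputable def Interp.fromChase (M : Interp NC NR NI) : SkolemTerm NR NI → M.dom
  | .ind a => M.ind a
  | .null d r => open Classical in
      if h : ∃ e, M.role r (M.fromChase d) e then h.choose else M.nonempty.some

/-- Truth of a chase fact under `fromChase`. -/
def Interp.SatFact (M : Interp NC NR NI) : Fact NC NR (SkolemTerm NR NI) → Prop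
  | .concept A d => M.fromChase d ∈ M.concept A
  | .role r d e => M.role r (M.fromChase d) (M.fromChase e)

/-- Induction on the derivation. When a null is created, the inclusion already supplies a successor
of the image of its parent, so the choice in `fromChase` never falls back to its default there. Only
positive axioms are required, so that the small model, which may violate disjointness, is an
admissible target. -/
theorem InChase.satFact {M : Interp NC NR NI} (hT : ∀ α ∈ T, α.IsPositive → M.SatAx α)
    (hA : ∀ α ∈ 𝒜, M.SatAssertion α) {f : Fact NC NR (SkolemTerm NR NI)}
    (hf : InChase T 𝒜 f) : M.SatFact f := by
  obtain ⟨n, hf⟩ := hf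
  induction hf with
  | concept h => exact hA _ h
  | role h => exact hA _ h
  | @subEx A r d n h _ ih =>
    have hex : ∃ e, M.role r (M.fromChase d) e := hT _ h trivial _ ih
    simp only [Interp.SatFact, Interp.fromChase, dif_pos hex]
    exact hex.choose_spec
  | sub h _ ih => exact hT _ h trivial _ ih
  | exSub h _ ih => exact hT _ h trivial _ _ ih
  | rsub h _ ih => exact hT _ h trivial _ _ ih
  | rsubInv h _ ih => exact hT _ h trivial _ _ ih
  | cri h _ _ ih₁ ih₂ => exact hT _ h trivial _ _ _ ih₁ ih₂

theorem smallModel_satAx [Nonempty NI] {α : TAxiom NC NR} (hα : α ∈ T) (hpos : α.IsPositive) :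
    (smallModel T 𝒜).SatAx α := by
  cases α with
  | sub => exact fun _ h => .sub hα h
  | subEx A p =>
    rintro (a | ⟨a, r⟩ | r) h
    · exact ⟨_, .subEx_ind hα h⟩
    · exact ⟨_, .subEx_wit hα h⟩
    · exact ⟨_, .subEx_shared hα h⟩
  | exSub => exact fun _ _ h => .exSub hα h
  | rsub => exact fun _ _ h => .rsub hα h
  | rsubInv => exact fun _ _ h => .rsubInv hα h
  | disjC => exact hpos.elim
  | disjR => exact hpos.elim
  | cri => exact fun _ _ _ h₁ h₂ => .cri hα h₁ h₂

theorem smallModel_satAssertion [Nonempty NI] {α : Assertion NC NR NI} (hα : α ∈ 𝒜) :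
    (smallModel T 𝒜).SatAssertion α := by
  cases α with
  | concept => exact SFact.concept hα
  | role => exact SFact.role hα

end Hom

/-! ### Soundness of the rewriting -/

section Soundness

variable {NC NR NI V : Type} {n : ℕ} {T : Set (TAxiom NC NR)}

theorem Interp.termVal_mapV (I : Interp NC NR NI) (π : V → I.dom) (σ : V → V) (t : Term NI V) :
    I.termVal π (t.mapV σ) = I.termVal (π ∘ σ) t := by
  cases t <;> rfl

theorem Interp.satAtom_mapV (I : Interp NC NR NI) (π : V → I.dom) (σ : V → V)
    (α : Atom NC NR NI V) : I.SatAtom π (α.mapV σ) ↔ I.SatAtom (π ∘ σ) α := by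
  cases α <;> simp [Atom.mapV, Interp.SatAtom, Interp.termVal_mapV]

theorem Interp.satAtom_congr (I : Interp NC NR NI) {π π' : V → I.dom} {α : Atom NC NR NI V}
    (h : ∀ x ∈ α.vars, π x = π' x) : I.SatAtom π α ↔ I.SatAtom π' α := by
  have key : ∀ t : Term NI V, (∀ x ∈ t.vars, π x = π' x) → I.termVal π t = I.termVal π' t := by
    rintro (x | a) ht
    · exact ht x rfl
    · rfl
  cases α with
  | concept A x => simp only [Interp.SatAtom, h x rfl]
  | role r x y => simp only [Interp.SatAtom, h x (.inl rfl), h y (.inr rfl)]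
  | eq t t' =>
    simp only [Interp.SatAtom, key t fun x hx => h x (.inl hx), key t' fun x hx => h x (.inr hx)]

theorem CQ.mem_replace {q : CQ NC NR NI V n} {α β : Atom NC NR NI V} {new : Set (Atom NC NR NI V)}
    {hnew : new.Finite} :
    β ∈ (q.replace α new hnew).atoms ↔ (β ≠ α ∧ β ∈ q.atoms) ∨ β ∈ new := by
  simp [CQ.replace]

theorem CQ.mem_subst {q : CQ NC NR NI V n} {x y : V} {β : Atom NC NR NI V} :
    β ∈ (q.subst x y).atoms ↔ (∃ α ∈ q.atoms, α.mapV (substV x y) = β) ∧ ¬ β.IsTrivial := by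
  simp [CQ.subst]

theorem Interp.satAtom_of_isTrivial (I : Interp NC NR NI) (π : V → I.dom) {α : Atom NC NR NI V}
    (h : α.IsTrivial) : I.SatAtom π α := by
  cases α with
  | concept => exact h.elim
  | role => exact h.elim
  | eq t t' => exact congrArg _ h

theorem Interp.IsAnswer.of_replace {I : Interp NC NR NI} {q : CQ NC NR NI V n}
    {α : Atom NC NR NI V} {new : Set (Atom NC NR NI V)} {hnew : new.Finite} {a : Fin n → I.dom}
    (h : I.IsAnswer (q.replace α new hnew) a)
    (himp : ∀ π : V → I.dom, (∀ β ∈ new, I.SatAtom π β) → I.SatAtom π α) : I.IsAnswer q a := by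
  obtain ⟨π, hπ, hat⟩ := h
  refine ⟨π, hπ, fun β hβ => ?_⟩
  by_cases hβα : β = α
  · exact hβα ▸ himp π fun γ hγ => hat γ (CQ.mem_replace.2 (.inr hγ))
  · exact hat β (CQ.mem_replace.2 (.inl ⟨hβα, hβ⟩))

/-- A match of the new query is also one of the old query, up to two adjustments. In `s2` the
eliminated variable is reassigned to an existential witness, which disturbs nothing as it occurs in
no other atom and not in the head. In `s7` the match is composed with the substitution; the dropped
equalities hold trivially. Freshness of `z q` plays no role in this direction. -/
theorem Step.isAnswer {z : CQ NC NR NI V n → V} {q q' : CQ NC NR NI V n} (hs : Step T z q q')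
    {I : Interp NC NR NI} (hI : ∀ α ∈ T, α.IsPositive → I.SatAx α) {a : Fin n → I.dom}
    (h : I.IsAnswer q' a) : I.IsAnswer q a := by
  cases hs with
  | s1 hax _ => exact h.of_replace fun π hπ => hI _ hax trivial _ (hπ _ rfl)
  | @s2 A r x y hax hmem hocc =>
    classical
    obtain ⟨π, hπ, hat⟩ := h
    have hx : π x ∈ I.concept A := hat (.concept A x) (CQ.mem_replace.2 (.inr rfl))
    obtain ⟨e, he⟩ := hI _ hax trivial _ hx
    obtain ⟨hhead, hyx, honly⟩ := hocc
    refine ⟨Function.update π y e, fun i => ?_, fun β hβ => ?_⟩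
    · rw [Function.update_of_ne fun hi => hhead ⟨i, hi⟩]
      exact hπ i
    · by_cases hβα : β = .role r x y
      · subst hβα
        simpa [Interp.SatAtom, Function.update_of_ne hyx.symm] using he
      · refine (I.satAtom_congr fun v hv => ?_).1 (hat β (CQ.mem_replace.2 (.inl ⟨hβα, hβ⟩)))
        rw [Function.update_of_ne]
        rintro rfl
        exact honly β hβ hβα hv
  | s3 hax _ => exact h.of_replace fun π hπ => hI _ hax trivial _ _ (hπ _ rfl)
  | s4 hax _ => exact h.of_replace fun π hπ => hI _ hax trivial _ _ (hπ _ rfl)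
  | s5 hax _ => exact h.of_replace fun π hπ => hI _ hax trivial _ _ (hπ _ rfl)
  | s6 hax _ =>
    exact h.of_replace fun π hπ => hI _ hax trivial _ _ _ (hπ _ (.inl rfl)) (hπ _ (.inr rfl))
  | @s7 x y _ _ =>
    obtain ⟨π, hπ, hat⟩ := h
    refine ⟨π ∘ substV x y, hπ, fun β hβ => (I.satAtom_mapV π _ β).1 ?_⟩
    by_cases htriv : (β.mapV (substV x y)).IsTrivial
    · exact I.satAtom_of_isTrivial π htriv
    · exact hat _ (CQ.mem_subst.2 ⟨⟨β, hβ, rfl⟩, htriv⟩)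

theorem isAnswer_of_mem_rew {z : CQ NC NR NI V n → V} {q q' : CQ NC NR NI V n}
    (hq : q' ∈ rew z q T) {I : Interp NC NR NI} (hI : ∀ α ∈ T, α.IsPositive → I.SatAx α)
    {a : Fin n → I.dom} (h : I.IsAnswer q' a) : I.IsAnswer q a := by
  change Relation.ReflTransGen (Step T z) q q' at hq
  induction hq with
  | refl => exact h
  | tail _ hs ih => exact ih (hs.isAnswer hI h)

end Soundness

theorem SkolemTerm.ne_null {NR NI : Type} (d : SkolemTerm NR NI) (r : NR) : d.null r ≠ d := fun h => by
  simpa [SkolemTerm.depth] using congrArg SkolemTerm.depth h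

/-! ### Completeness of the rewriting for the chase -/

section Completeness

variable {NC NR NI V : Type} {n : ℕ} {T : Set (TAxiom NC NR)} {𝒜 : Set (Assertion NC NR NI)}

/-- The least size of a derivation of a fact. -/
noncomputable def factRank (T : Set (TAxiom NC NR)) (𝒜 : Set (Assertion NC NR NI))
    (f : Fact NC NR (SkolemTerm NR NI)) : ℕ :=
  sInf {n | Derives T 𝒜 n f}

theorem Derives.factRank_le {m : ℕ} {f : Fact NC NR (SkolemTerm NR NI)} (h : Derives T 𝒜 m f) :
    factRank T 𝒜 f ≤ m :=
  Nat.sInf_le h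

theorem InChase.derives_factRank {f : Fact NC NR (SkolemTerm NR NI)} (h : InChase T 𝒜 f) :
    Derives T 𝒜 (factRank T 𝒜 f) f :=
  Nat.sInf_mem (s := {n | Derives T 𝒜 n f}) h

theorem InChase.concept_cases {A : NC} {d : SkolemTerm NR NI} (h : InChase T 𝒜 (.concept A d)) :
    (∃ a, d = .ind a ∧ .concept A a ∈ 𝒜) ∨
    (∃ A', .sub A' A ∈ T ∧ InChase T 𝒜 (.concept A' d) ∧
      factRank T 𝒜 (.concept A' d) < factRank T 𝒜 (.concept A d)) ∨
    (∃ p e, .exSub p A ∈ T ∧ InChase T 𝒜 (.role p d e) ∧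
      factRank T 𝒜 (.role p d e) < factRank T 𝒜 (.concept A d)) := by
  have h' := h.derives_factRank
  generalize factRank T 𝒜 (.concept A d) = m at h'
  cases h' with
  | concept hA => exact .inl ⟨_, rfl, hA⟩
  | sub hax hd => exact .inr (.inl ⟨_, hax, ⟨_, hd⟩, Nat.lt_succ_of_le hd.factRank_le⟩)
  | exSub hax hd => exact .inr (.inr ⟨_, _, hax, ⟨_, hd⟩, Nat.lt_succ_of_le hd.factRank_le⟩)

/-- Inspect the last rule of a derivation of least size. Since size counts all rule applications,
the ranks of the two premises of a CRI are smaller even in sum; height would not give this. -/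
theorem InChase.role_cases {r : NR} {d e : SkolemTerm NR NI} (h : InChase T 𝒜 (.role r d e)) :
    (∃ a b, d = .ind a ∧ e = .ind b ∧ .role r a b ∈ 𝒜) ∨
    (∃ A, .subEx A r ∈ T ∧ e = .null d r ∧ InChase T 𝒜 (.concept A d) ∧
      factRank T 𝒜 (.concept A d) < factRank T 𝒜 (.role r d e)) ∨
    (∃ p, .rsub p r ∈ T ∧ InChase T 𝒜 (.role p d e) ∧
      factRank T 𝒜 (.role p d e) < factRank T 𝒜 (.role r d e)) ∨
    (∃ p, .rsubInv p r ∈ T ∧ InChase T 𝒜 (.role p e d) ∧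
      factRank T 𝒜 (.role p e d) < factRank T 𝒜 (.role r d e)) ∨
    (∃ p s f, .cri p s r ∈ T ∧ InChase T 𝒜 (.role p d f) ∧ InChase T 𝒜 (.role s f e) ∧
      factRank T 𝒜 (.role p d f) + factRank T 𝒜 (.role s f e) < factRank T 𝒜 (.role r d e)) := by
  have h' := h.derives_factRank
  generalize factRank T 𝒜 (.role r d e) = m at h'
  cases h' with
  | role hA => exact .inl ⟨_, _, rfl, rfl, hA⟩
  | subEx hax hd => exact .inr (.inl ⟨_, hax, rfl, ⟨_, hd⟩, Nat.lt_succ_of_le hd.factRank_le⟩)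
  | rsub hax hd =>
    exact .inr (.inr (.inl ⟨_, hax, ⟨_, hd⟩, Nat.lt_succ_of_le hd.factRank_le⟩))
  | rsubInv hax hd =>
    exact .inr (.inr (.inr (.inl ⟨_, hax, ⟨_, hd⟩, Nat.lt_succ_of_le hd.factRank_le⟩)))
  | cri hax h₁ h₂ =>
    exact .inr (.inr (.inr (.inr ⟨_, _, _, hax, ⟨_, h₁⟩, ⟨_, h₂⟩,
      Nat.lt_succ_of_le (Nat.add_le_add h₁.factRank_le h₂.factRank_le)⟩)))

/-- The rank of the fact to which an atom is matched; equalities count one. -/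
noncomputable def Atom.rank (T : Set (TAxiom NC NR)) (𝒜 : Set (Assertion NC NR NI))
    (π : V → SkolemTerm NR NI) : Atom NC NR NI V → ℕ
  | .concept A x => factRank T 𝒜 (.concept A (π x))
  | .role r x y => factRank T 𝒜 (.role r (π x) (π y))
  | .eq _ _ => 1

theorem Atom.rank_mapV (π : V → SkolemTerm NR NI) (σ : V → V) (α : Atom NC NR NI V) :
    (α.mapV σ).rank T 𝒜 π = α.rank T 𝒜 (π ∘ σ) := by
  cases α <;> rfl

theorem Atom.rank_congr {π π' : V → SkolemTerm NR NI} {α : Atom NC NR NI V}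
    (h : ∀ x ∈ α.vars, π x = π' x) : α.rank T 𝒜 π = α.rank T 𝒜 π' := by
  cases α with
  | concept A x => simp only [Atom.rank, h x rfl]
  | role r x y => simp only [Atom.rank, h x (.inl rfl), h y (.inr rfl)]
  | eq => rfl

/-- The total rank of a matched query. -/
noncomputable def CQ.rank (T : Set (TAxiom NC NR)) (𝒜 : Set (Assertion NC NR NI))
    (π : V → SkolemTerm NR NI) (q : CQ NC NR NI V n) : ℕ :=
  ∑ α ∈ q.atoms, α.rank T 𝒜 π

theorem Atom.vars_finite (α : Atom NC NR NI V) : α.vars.Finite := by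
  have key : ∀ t : Term NI V, t.vars.Finite := by
    rintro (x | a)
    · exact Set.finite_singleton x
    · exact Set.finite_empty
  cases α with
  | concept => exact Set.finite_singleton _
  | role => exact (Set.finite_singleton _).insert _
  | eq t t' => exact (key t).union (key t')

theorem CQ.vars_finite (q : CQ NC NR NI V n) : q.vars.Finite := by
  refine (Set.finite_range _).union ?_
  have : {x | ∃ α ∈ q.atoms, x ∈ α.vars} = ⋃ α ∈ q.atoms, α.vars := by ext; simp
  rw [this]
  exact q.atoms.finite_toSet.biUnion fun α _ => α.vars_finite

theorem Atom.mem_vars_mapV {σ : V → V} {α : Atom NC NR NI V} {v : V} (h : v ∈ (α.mapV σ).vars) :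
    ∃ u ∈ α.vars, σ u = v := by
  have key : ∀ t : Term NI V, v ∈ (t.mapV σ).vars → ∃ u ∈ t.vars, σ u = v := by
    rintro (x | a) ht
    · exact ⟨x, rfl, Eq.symm ht⟩
    · exact ht.elim
  cases α with
  | concept A x => exact ⟨x, rfl, Eq.symm h⟩
  | role r x y =>
    rcases h with h | h
    · exact ⟨x, .inl rfl, Eq.symm h⟩
    · exact ⟨y, .inr rfl, Eq.symm h⟩
  | eq t t' =>
    rcases h with h | h
    · obtain ⟨u, hu, rfl⟩ := key t h
      exact ⟨u, .inl hu, rfl⟩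
    · obtain ⟨u, hu, rfl⟩ := key t' h
      exact ⟨u, .inr hu, rfl⟩

theorem CQ.vars_subst_subset {q : CQ NC NR NI V n} {x y : V} (hxy : x ≠ y) (hy : y ∈ q.vars) :
    (q.subst x y).vars ⊆ q.vars \ {x} := by
  have key : ∀ u ∈ q.vars, substV x y u ∈ q.vars \ {x} := by
    intro u hu
    by_cases hux : u = x
    · simpa [substV, hux] using ⟨hy, hxy.symm⟩
    · simpa [substV, hux] using hu
  rintro v (⟨i, rfl⟩ | ⟨β, hβ, hv⟩)
  · exact key _ (.inl ⟨i, rfl⟩)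
  · obtain ⟨⟨α, hα, rfl⟩, -⟩ := CQ.mem_subst.1 hβ
    obtain ⟨u, hu, rfl⟩ := Atom.mem_vars_mapV hv
    exact key u (.inr ⟨α, hα, hu⟩)

theorem comp_substV {D : Type} {π : V → D} {x y : V} (h : π x = π y) : π ∘ substV x y = π := by
  funext v
  by_cases hv : v = x
  · simp [substV, hv, h]
  · simp [substV, hv]

theorem CQ.rank_subst_le {π : V → SkolemTerm NR NI} {q : CQ NC NR NI V n} {x y : V}
    (h : π x = π y) : (q.subst x y).rank T 𝒜 π ≤ q.rank T 𝒜 π := by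
  classical
  calc (q.subst x y).rank T 𝒜 π
      ≤ ∑ β ∈ q.atoms.image (Atom.mapV (substV x y)), β.rank T 𝒜 π := by
        refine Finset.sum_le_sum_of_subset fun β hβ => ?_
        obtain ⟨⟨α, hα, rfl⟩, -⟩ := CQ.mem_subst.1 hβ
        exact Finset.mem_image_of_mem _ hα
    _ ≤ ∑ α ∈ q.atoms, (α.mapV (substV x y)).rank T 𝒜 π :=
        Finset.sum_image_le_of_nonneg fun _ _ => Nat.zero_le _
    _ = q.rank T 𝒜 π := by simp only [Atom.rank_mapV, comp_substV h, CQ.rank]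

/-- The equality becomes trivial and is dropped; its rank of one makes this a strict decrease, also
when `x = y`. -/
theorem CQ.rank_subst_lt {π : V → SkolemTerm NR NI} {q : CQ NC NR NI V n} {x y : V}
    (h : π x = π y) (hmem : .eq (.var x) (.var y) ∈ q.atoms) :
    (q.subst x y).rank T 𝒜 π < q.rank T 𝒜 π := by
  classical
  have hsub : (q.subst x y).atoms ⊆
      (q.atoms.erase (.eq (.var x) (.var y))).image (Atom.mapV (substV x y)) := by
    intro β hβ
    obtain ⟨⟨α, hα, rfl⟩, htriv⟩ := CQ.mem_subst.1 hβ
    refine Finset.mem_image_of_mem _ (Finset.mem_erase.2 ⟨?_, hα⟩)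
    rintro rfl
    exact htriv (by simp [Atom.mapV, Term.mapV, Atom.IsTrivial, substV])
  calc (q.subst x y).rank T 𝒜 π
      ≤ ∑ β ∈ (q.atoms.erase (.eq (.var x) (.var y))).image (Atom.mapV (substV x y)),
          β.rank T 𝒜 π := Finset.sum_le_sum_of_subset hsub
    _ ≤ ∑ α ∈ q.atoms.erase (.eq (.var x) (.var y)), (α.mapV (substV x y)).rank T 𝒜 π :=
        Finset.sum_image_le_of_nonneg fun _ _ => Nat.zero_le _
    _ = ∑ α ∈ q.atoms.erase (.eq (.var x) (.var y)), α.rank T 𝒜 π := by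
        simp only [Atom.rank_mapV, comp_substV h]
    _ < q.rank T 𝒜 π := by
        rw [CQ.rank, ← Finset.add_sum_erase _ _ hmem]
        simp [Atom.rank]

/-- `π` matches `q` in the chase and sends the answer variables to the individuals `a`. -/
def CQ.Matches [Nonempty NI] (T : Set (TAxiom NC NR)) (𝒜 : Set (Assertion NC NR NI))
    (q : CQ NC NR NI V n) (π : V → SkolemTerm NR NI) (a : Fin n → NI) : Prop :=
  (∀ i, π (q.head i) = .ind (a i)) ∧ ∀ α ∈ q.atoms, (chase T 𝒜).SatAtom π α

variable [Nonempty NI]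

theorem CQ.Matches.subst {q : CQ NC NR NI V n} {π : V → SkolemTerm NR NI} {a : Fin n → NI}
    (hm : q.Matches T 𝒜 π a) {x y : V} (h : π x = π y) : (q.subst x y).Matches T 𝒜 π a := by
  have hσ := comp_substV h
  refine ⟨fun i => (congrFun hσ _).trans (hm.1 i), fun β hβ => ?_⟩
  obtain ⟨⟨α, hα, rfl⟩, -⟩ := CQ.mem_subst.1 hβ
  refine ((chase T 𝒜).satAtom_mapV π _ α).2 ?_
  have := hm.2 α hα
  rw [← hσ] at this
  exact this

/-- Variables with the same image are merged one pair at a time; each merge removes a variable and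
does not raise the rank. Injectivity is what later makes two atoms ending in the same null coincide.
-/
theorem CQ.Matches.exists_injOn {q : CQ NC NR NI V n} {π : V → SkolemTerm NR NI}
    {a : Fin n → NI} (z : CQ NC NR NI V n → V) (hm : q.Matches T 𝒜 π a) :
    ∃ q' ∈ rew z q T, q'.Matches T 𝒜 π a ∧ q'.rank T 𝒜 π ≤ q.rank T 𝒜 π ∧
      Set.InjOn π q'.vars := by
  induction hk : q.vars.ncard using Nat.strong_induction_on generalizing q with
  | _ k ih =>
    by_cases hinj : Set.InjOn π q.vars
    · exact ⟨q, .refl, hm, le_rfl, hinj⟩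
    · simp only [Set.InjOn, not_forall] at hinj
      obtain ⟨x, hx, y, hy, hπ, hxy⟩ := hinj
      have hlt : (q.subst x y).vars.ncard < k := hk ▸
        (Set.ncard_le_ncard (CQ.vars_subst_subset hxy hy) q.vars_finite.sdiff).trans_lt
          (Set.ncard_sdiff_singleton_lt_of_mem hx q.vars_finite)
      obtain ⟨q', hq', hm', hr, hi⟩ := ih _ hlt (hm.subst hπ) rfl
      exact ⟨q', .head (.s7 hx hy) hq', hm', hr.trans (CQ.rank_subst_le hπ), hi⟩

/-- Replacing an atom by atoms with a match of smaller total rank, where the variable `v` (which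
does not occur in `q`) may be given a new value. -/
theorem CQ.Matches.replace {q : CQ NC NR NI V n} {π : V → SkolemTerm NR NI} {a : Fin n → NI}
    (hm : q.Matches T 𝒜 π a) {α : Atom NC NR NI V} (hα : α ∈ q.atoms)
    {new : Finset (Atom NC NR NI V)} {S : Set (Atom NC NR NI V)} (hS : S = new) {hfin : S.Finite}
    {π' : V → SkolemTerm NR NI} (hπ' : ∀ x ∈ q.vars, π' x = π x)
    (hnew : ∀ β ∈ new, (chase T 𝒜).SatAtom π' β)
    (hrank : ∑ β ∈ new, β.rank T 𝒜 π' < α.rank T 𝒜 π) :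
    (q.replace α S hfin).Matches T 𝒜 π' a ∧
      (q.replace α S hfin).rank T 𝒜 π' < q.rank T 𝒜 π := by
  classical
  subst hS
  refine ⟨⟨fun i => (hπ' _ (.inl ⟨i, rfl⟩)).trans (hm.1 i), fun β hβ => ?_⟩, ?_⟩
  · rcases CQ.mem_replace.1 hβ with ⟨-, hβ⟩ | hβ
    · exact ((chase T 𝒜).satAtom_congr fun x hx => (hπ' x (.inr ⟨β, hβ, hx⟩)).symm).1 (hm.2 β hβ)
    · exact hnew β hβ
  · have hsub : (q.replace α new hfin).atoms ⊆ q.atoms.erase α ∪ new := by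
      intro β hβ
      rcases CQ.mem_replace.1 hβ with ⟨h₁, h₂⟩ | hβ
      · exact Finset.mem_union_left _ (Finset.mem_erase.2 ⟨h₁, h₂⟩)
      · exact Finset.mem_union_right _ hβ
    have hle := Finset.sum_union_inter (s₁ := q.atoms.erase α) (s₂ := new)
      (f := fun β => β.rank T 𝒜 π')
    calc (q.replace α new hfin).rank T 𝒜 π'
        ≤ ∑ β ∈ q.atoms.erase α ∪ new, β.rank T 𝒜 π' := Finset.sum_le_sum_of_subset hsub
      _ ≤ ∑ β ∈ q.atoms.erase α, β.rank T 𝒜 π' + ∑ β ∈ new, β.rank T 𝒜 π' := by omega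
      _ = ∑ β ∈ q.atoms.erase α, β.rank T 𝒜 π + ∑ β ∈ new, β.rank T 𝒜 π' := by
        refine congrArg (· + _) (Finset.sum_congr rfl fun β hβ => Atom.rank_congr fun x hx => ?_)
        exact hπ' x (.inr ⟨β, Finset.mem_of_mem_erase hβ, hx⟩)
      _ < ∑ β ∈ q.atoms.erase α, β.rank T 𝒜 π + α.rank T 𝒜 π := by omega
      _ = q.rank T 𝒜 π := Finset.sum_erase_add _ _ hα


/-- Strong induction on the rank, after making the match injective. Every concept or role atom on a
derived fact whose last rule is not `A ⊑ ∃r` is rewritten backwards at once. What remains is ABox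
facts and edges into nulls created by that rule, and the latter are removed from the deepest null
upwards. -/
theorem CQ.Matches.exists_mem_rew {z : CQ NC NR NI V n → V} (hz : ∀ p, z p ∉ p.vars)
    {q : CQ NC NR NI V n} {π : V → SkolemTerm NR NI} {a : Fin n → NI}
    (hm : q.Matches T 𝒜 π a) :
    ∃ q' ∈ rew z q T, (aboxInterp 𝒜).IsAnswer q' a := by
  classical
  induction hk : q.rank T 𝒜 π using Nat.strong_induction_on generalizing q π with
  | _ k ih =>
  obtain ⟨p, hp, hm, hrank, hinj⟩ := hm.exists_injOn z
  subst hk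
  have hstep : ∀ {p' π'}, Step T z p p' → p'.Matches T 𝒜 π' a ∧ p'.rank T 𝒜 π' < p.rank T 𝒜 π →
      ∃ q' ∈ rew z q T, (aboxInterp 𝒜).IsAnswer q' a := by
    intro p' π' hs h
    obtain ⟨q', hq', ha⟩ := ih _ (h.2.trans_le hrank) h.1 rfl
    exact ⟨q', hp.trans (.head hs hq'), ha⟩
  have hvar : ∀ {α : Atom NC NR NI V} {x}, α ∈ p.atoms → x ∈ α.vars → x ∈ p.vars :=
    fun hα hx => .inr ⟨_, hα, hx⟩
  -- As `z p` is fresh, it can be sent to the intermediate chase element without changing the match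
  -- on `p`.
  have hupd : ∀ d, ∀ x ∈ p.vars, Function.update π (z p) d x = π x := fun d x hx =>
    Function.update_of_ne (fun h => hz p (by rwa [← h])) _ _
  by_cases heq : ∃ x y, .eq (.var x) (.var y) ∈ p.atoms
  · obtain ⟨x, y, hmem⟩ := heq
    have hxy : π x = π y := hm.2 _ hmem
    exact hstep (.s7 (hvar hmem (.inl rfl)) (hvar hmem (.inr rfl)))
      ⟨hm.subst hxy, CQ.rank_subst_lt hxy hmem⟩
  have hconcept : (∃ q' ∈ rew z q T, (aboxInterp 𝒜).IsAnswer q' a) ∨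
      ∀ A x, .concept A x ∈ p.atoms → ∃ b, π x = .ind b ∧ .concept A b ∈ 𝒜 := by
    refine or_iff_not_imp_right.2 fun h => ?_
    push Not at h
    obtain ⟨A, x, hmem, hno⟩ := h
    have hx := hvar hmem rfl
    rcases InChase.concept_cases (hm.2 _ hmem) with ⟨b, hb, hA⟩ | ⟨A', hax, hd, hlt⟩ |
      ⟨r, e, hax, hd, hlt⟩
    · exact (hno b hb hA).elim
    · exact hstep (.s1 hax hmem) (hm.replace hmem (new := {.concept A' x}) (by simp)
        (π' := π) (fun _ _ => rfl) (fun β hβ => by obtain rfl := Finset.mem_singleton.1 hβ; exact hd)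
        (by simpa [Atom.rank] using hlt))
    · refine hstep (.s3 hax hmem) (hm.replace hmem (new := {.role r x (z p)}) (by simp)
        (hupd e) ?_ ?_)
      · simpa [Interp.SatAtom, chase, hupd e x hx] using hd
      · simpa [Atom.rank, hupd e x hx] using hlt
  rcases hconcept with h | hconcept
  · exact h
  have hrole : (∃ q' ∈ rew z q T, (aboxInterp 𝒜).IsAnswer q' a) ∨
      ∀ r x y, .role r x y ∈ p.atoms →
        (∃ b c, π x = .ind b ∧ π y = .ind c ∧ .role r b c ∈ 𝒜) ∨
        (∃ A, .subEx A r ∈ T ∧ π y = .null (π x) r ∧ InChase T 𝒜 (.concept A (π x)) ∧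
          factRank T 𝒜 (.concept A (π x)) < factRank T 𝒜 (.role r (π x) (π y))) := by
    refine or_iff_not_imp_right.2 fun h => ?_
    simp only [not_forall] at h
    obtain ⟨r, x, y, hmem, hno⟩ := h
    have hx := hvar hmem (.inl rfl)
    have hy := hvar hmem (.inr rfl)
    rcases InChase.role_cases (hm.2 _ hmem) with hA | hA | ⟨s, hax, hd, hlt⟩ |
      ⟨s, hax, hd, hlt⟩ | ⟨s, t, e, hax, hd₁, hd₂, hlt⟩
    · exact (hno (.inl hA)).elim
    · exact (hno (.inr hA)).elim
    · exact hstep (.s4 hax hmem) (hm.replace hmem (new := {.role s x y}) (by simp)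
        (π' := π) (fun _ _ => rfl) (fun β hβ => by obtain rfl := Finset.mem_singleton.1 hβ; exact hd)
        (by simpa [Atom.rank] using hlt))
    · exact hstep (.s5 hax hmem) (hm.replace hmem (new := {.role s y x}) (by simp)
        (π' := π) (fun _ _ => rfl) (fun β hβ => by obtain rfl := Finset.mem_singleton.1 hβ; exact hd)
        (by simpa [Atom.rank] using hlt))
    · refine hstep (.s6 hax hmem) (hm.replace hmem
        (new := {.role s x (z p), .role t (z p) y}) (by simp) (hupd e) ?_ ?_)
      · simpa [Interp.SatAtom, chase, hupd e x hx, hupd e y hy] using ⟨hd₁, hd₂⟩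
      · have hne : Atom.role s x (z p) ≠ (.role t (z p) y : Atom NC NR NI V) := fun h => by
          injection h with _ h _
          exact hz p (h ▸ hx)
        rw [Finset.sum_pair hne]
        simpa [Atom.rank, hupd e x hx, hupd e y hy] using hlt
  rcases hrole with h | hrole
  · exact h
  -- Pick an edge into a null of maximal depth. Its target `y` is no answer variable and lies in no
  -- concept atom or equality, as those would force an individual. It is not the source of another
  -- edge, whose target would be deeper. Another edge into it has the same role and parent, hence by
  -- injectivity is the same atom. So `s2` applies.
  by_cases hex : (p.atoms.filter fun α => ∃ r x y, α = .role r x y ∧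
      π y = .null (π x) r).Nonempty
  · let target : Atom NC NR NI V → ℕ
      | .role _ _ y => (π y).depth
      | _ => 0
    obtain ⟨α, hα, hmax⟩ := Finset.exists_max_image _ target hex
    obtain ⟨hmem, r, x, y, rfl, hxy⟩ := Finset.mem_filter.1 hα
    have hx := hvar hmem (.inl rfl)
    have hy := hvar hmem (.inr rfl)
    rcases hrole r x y hmem with ⟨b, c, hb, hc, -⟩ | ⟨A, hax, -, hd, hlt⟩
    · rw [hc] at hxy
      cases hxy
    have hocc : p.OccursOnce r x y := by
      refine ⟨?_, ?_, ?_⟩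
      · rintro ⟨i, rfl⟩
        rw [hm.1 i] at hxy
        cases hxy
      · rintro rfl
        exact SkolemTerm.ne_null _ _ hxy.symm
      · intro β hβ hne hyβ
        cases β with
        | concept B u =>
          obtain rfl : y = u := hyβ
          obtain ⟨b, hb, -⟩ := hconcept _ _ hβ
          rw [hb] at hxy
          cases hxy
        | role s u v =>
          rcases hrole s u v hβ with ⟨b, c, hb, hc, -⟩ | ⟨B, -, hv, -⟩
          · rcases hyβ with rfl | hyβ
            · rw [hb] at hxy
              cases hxy
            · obtain rfl : y = v := hyβ
              rw [hc] at hxy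
              cases hxy
          · rcases hyβ with rfl | hyβ
            · have := hmax _ (Finset.mem_filter.2 ⟨hβ, s, y, v, rfl, hv⟩)
              simp [target, hv, SkolemTerm.depth] at this
            · obtain rfl : y = v := hyβ
              rw [hxy] at hv
              injection hv with h₁ h₂
              exact hne (by rw [h₂, hinj hx (hvar hβ (.inl rfl)) h₁])
        | eq t t' =>
          have hsat : (chase T 𝒜).termVal π t = (chase T 𝒜).termVal π t' := hm.2 _ hβ
          rcases t with u | b <;> rcases t' with v | c
          · exact heq ⟨u, v, hβ⟩
          · rcases hyβ with hyβ | hyβ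
            · obtain rfl : y = u := hyβ
              cases hxy.symm.trans hsat
            · exact hyβ
          · rcases hyβ with hyβ | hyβ
            · exact hyβ
            · obtain rfl : y = v := hyβ
              cases hxy.symm.trans hsat.symm
          · exact hyβ.elim id id
    exact hstep (.s2 hax hmem hocc) (hm.replace hmem (new := {.concept A x}) (by simp)
      (π' := π) (fun _ _ => rfl) (fun β hβ => by obtain rfl := Finset.mem_singleton.1 hβ; exact hd)
        (by simpa [Atom.rank] using hlt))
  · have hrole' : ∀ r x y, .role r x y ∈ p.atoms →
        ∃ b c, π x = .ind b ∧ π y = .ind c ∧ .role r b c ∈ 𝒜 := fun r x y hmem =>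
      (hrole r x y hmem).resolve_right fun ⟨_, _, hxy, _⟩ =>
        hex ⟨_, Finset.mem_filter.2 ⟨hmem, r, x, y, rfl, hxy⟩⟩
    -- The value on nulls is irrelevant: concept and role atoms now involve individuals only, and
    -- equalities survive any map that fixes individuals.
    let toInd : SkolemTerm NR NI → NI
      | .ind b => b
      | .null _ _ => Classical.arbitrary NI
    refine ⟨p, hp, toInd ∘ π, fun i => congrArg toInd (hm.1 i), fun α hα => ?_⟩
    cases α with
    | concept A x =>
      obtain ⟨b, hb, hA⟩ := hconcept A x hα
      change Assertion.concept A (toInd (π x)) ∈ 𝒜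
      rwa [hb]
    | role r x y =>
      obtain ⟨b, c, hb, hc, hA⟩ := hrole' r x y hα
      change Assertion.role r (toInd (π x)) (toInd (π y)) ∈ 𝒜
      rwa [hb, hc]
    | eq t t' =>
      have key : ∀ t : Term NI V, (aboxInterp 𝒜).termVal (toInd ∘ π) t =
          toInd ((chase T 𝒜).termVal π t) := by rintro (x | b) <;> rfl
      change (aboxInterp 𝒜).termVal _ t = (aboxInterp 𝒜).termVal _ t'
      rw [key, key]
      exact congrArg toInd (hm.2 _ hα)

end Completeness

/-! ### The unfolding -/

section Unfold

/-- The role name that a role name of the unfolding stands for. -/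
def XRole.proj {NR : Type} : XRole NR → NR
  | .base r => r
  | .level r _ => r
  | .hat r => r

/-- An interpretation read over the extended role names. -/
def Interp.extend {NC NR NI : Type} (M : Interp NC NR NI) : Interp NC (XRole NR) NI where
  dom := M.dom
  nonempty := M.nonempty
  ind := M.ind
  ind_injective := M.ind_injective
  concept := M.concept
  role := fun r => M.role r.proj

variable {NC NR NI V : Type} {n : ℕ} {simple : Set NR} {T : Set (TAxiom NC NR)}
  {𝒜 : Set (Assertion NC NR NI)} {k : ℕ}

/-- When all copies of `r` are identified, the entry and exit axioms of the levels become `r ⊑ r`,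
and each counting axiom becomes the original CRI. -/
theorem Interp.extend_satAx {M : Interp NC NR NI} (hM : ∀ α ∈ T, α.IsPositive → M.SatAx α)
    {β : TAxiom NC (XRole NR)} (hβ : Unfolding T k β) (hpos : β.IsPositive) :
    M.extend.SatAx β := by
  cases hβ with
  | @keep α hα _ => cases α <;> first | exact hM _ hα trivial | exact hpos.elim
  | start => exact fun _ _ h => h
  | next h _ => exact hM _ h trivial
  | finish => exact fun _ _ h => h
  | rsub_hat _ h _ => exact hM _ h trivial
  | rsubInv_hat _ h => exact hM _ h trivial
  | cri_hat _ h _ => exact hM _ h trivial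

theorem Interp.extend_satAssertion {M : Interp NC NR NI} (hM : ∀ α ∈ 𝒜, M.SatAssertion α) :
    ∀ β ∈ liftABox 𝒜, M.extend.SatAssertion β := by
  rintro _ ⟨α, hα, rfl⟩
  have := hM α hα
  cases α <;> exact this

theorem hatRole_proj (r : NR) : (hatRole T r).proj = r := by
  unfold hatRole
  split <;> rfl

theorem hatRole_of_mem_simple (hT : IsTBox simple T) {s : NR} (hs : s ∈ simple) :
    hatRole T s = .base s := by
  unfold hatRole
  rw [if_neg]
  rintro ⟨t, ht⟩
  exact hT.cri_head _ _ _ ht hs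

theorem Interp.extend_isAnswer_hatQuery {M : Interp NC NR NI} {q : CQ NC NR NI V n}
    {a : Fin n → M.dom} (h : M.extend.IsAnswer (hatQuery T q) a) : M.IsAnswer q a := by
  obtain ⟨π, hπ, hat⟩ := h
  refine ⟨π, hπ, fun α hα => ?_⟩
  have h := hat (α.mapR (hatRole T)) (by
    simpa [hatQuery] using ⟨α, hα, rfl⟩)
  cases α with
  | concept => exact h
  | role r x y =>
    change M.role (hatRole T r).proj _ _ at h
    rwa [hatRole_proj] at h
  | eq t t' => cases t <;> cases t' <;> exact h

/-- The chase of the unfolding. -/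
abbrev InUnfoldingChase (T : Set (TAxiom NC NR)) (k : ℕ) (𝒜 : Set (Assertion NC NR NI)) :
    Fact NC (XRole NR) (SkolemTerm (XRole NR) NI) → Prop :=
  InChase {α | Unfolding T k α} (liftABox 𝒜)

/-- Kept axioms and the lifted ABox mention only `base` names, so the level facts come solely from
the axioms that introduce the levels. The next two lemmas rest on the same inspection. -/
theorem InUnfoldingChase.of_level_zero {r : NR} {d e : SkolemTerm (XRole NR) NI}
    (h : InUnfoldingChase T k 𝒜 (.role (.level r 0) d e)) :
    InUnfoldingChase T k 𝒜 (.role (.base r) d e) := by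
  rcases h.role_cases with ⟨a, b, -, -, α, -, hα⟩ | ⟨A, hax, -⟩ | ⟨p, hax, hd, -⟩ |
    ⟨p, hax, -⟩ | ⟨p, s, f, hax, -⟩
  · cases α <;> simp [Assertion.mapR] at hα
  · generalize hβ : TAxiom.subEx A (XRole.level r 0) = β at hax
    cases hax with
    | @keep α _ _ => cases α <;> simp [TAxiom.mapR] at hβ
    | _ => cases hβ
  · generalize hβ : TAxiom.rsub p (XRole.level r 0) = β at hax
    cases hax with
    | @keep α _ _ => cases α <;> simp [TAxiom.mapR] at hβ
    | start => cases hβ; exact hd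
    | _ => cases hβ
  · generalize hβ : TAxiom.rsubInv p (XRole.level r 0) = β at hax
    cases hax with
    | @keep α _ _ => cases α <;> simp [TAxiom.mapR] at hβ
    | _ => cases hβ
  · generalize hβ : TAxiom.cri p s (XRole.level r 0) = β at hax
    cases hax with
    | @keep α _ _ => cases α <;> simp [TAxiom.mapR] at hβ
    | _ => cases hβ

theorem InUnfoldingChase.of_level_succ {r : NR} {j : ℕ} {d e : SkolemTerm (XRole NR) NI}
    (h : InUnfoldingChase T k 𝒜 (.role (.level r (j + 1)) d e)) :
    ∃ s f, s ∈ guards T r ∧ InUnfoldingChase T k 𝒜 (.role (.level r j) d f) ∧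
      InUnfoldingChase T k 𝒜 (.role (.base s) f e) := by
  rcases h.role_cases with ⟨a, b, -, -, α, -, hα⟩ | ⟨A, hax, -⟩ | ⟨p, hax, -⟩ |
    ⟨p, hax, -⟩ | ⟨p, s, f, hax, hd₁, hd₂, -⟩
  · cases α <;> simp [Assertion.mapR] at hα
  · generalize hβ : TAxiom.subEx A (XRole.level r (j + 1)) = β at hax
    cases hax with
    | @keep α _ _ => cases α <;> simp [TAxiom.mapR] at hβ
    | _ => cases hβ
  · generalize hβ : TAxiom.rsub p (XRole.level r (j + 1)) = β at hax
    cases hax with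
    | @keep α _ _ => cases α <;> simp [TAxiom.mapR] at hβ
    | _ => cases hβ
  · generalize hβ : TAxiom.rsubInv p (XRole.level r (j + 1)) = β at hax
    cases hax with
    | @keep α _ _ => cases α <;> simp [TAxiom.mapR] at hβ
    | _ => cases hβ
  · generalize hβ : TAxiom.cri p s (XRole.level r (j + 1)) = β at hax
    cases hax with
    | @keep α _ _ => cases α <;> simp [TAxiom.mapR] at hβ
    | next h _ => cases hβ; exact ⟨_, f, h, hd₁, hd₂⟩
    | _ => cases hβ

theorem InUnfoldingChase.of_hat {r : NR} {d e : SkolemTerm (XRole NR) NI}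
    (h : InUnfoldingChase T k 𝒜 (.role (.hat r) d e)) :
    ∃ j, InUnfoldingChase T k 𝒜 (.role (.level r j) d e) := by
  rcases h.role_cases with ⟨a, b, -, -, α, -, hα⟩ | ⟨A, hax, -⟩ | ⟨p, hax, hd, -⟩ |
    ⟨p, hax, -⟩ | ⟨p, s, f, hax, -⟩
  · cases α <;> simp [Assertion.mapR] at hα
  · generalize hβ : TAxiom.subEx A (XRole.hat r) = β at hax
    cases hax with
    | @keep α _ _ => cases α <;> simp [TAxiom.mapR] at hβ
    | _ => cases hβ
  · generalize hβ : TAxiom.rsub p (XRole.hat r) = β at hax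
    cases hax with
    | @keep α _ _ => cases α <;> simp [TAxiom.mapR] at hβ
    | finish => cases hβ; exact ⟨_, hd⟩
    | _ => cases hβ
  · generalize hβ : TAxiom.rsubInv p (XRole.hat r) = β at hax
    cases hax with
    | @keep α _ _ => cases α <;> simp [TAxiom.mapR] at hβ
    | _ => cases hβ
  · generalize hβ : TAxiom.cri p s (XRole.hat r) = β at hax
    cases hax with
    | @keep α _ _ => cases α <;> simp [TAxiom.mapR] at hβ
    | _ => cases hβ

/-- A recursive step moves only the second component, so the source of an `r_j`-edge already has an
`r`-edge. This is why `∃r ⊑ A` needs no copy for `r̂`. -/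
theorem InUnfoldingChase.exists_base_of_level {r : NR} {j : ℕ} {d e : SkolemTerm (XRole NR) NI}
    (h : InUnfoldingChase T k 𝒜 (.role (.level r j) d e)) :
    ∃ f, InUnfoldingChase T k 𝒜 (.role (.base r) d f) := by
  induction j generalizing e with
  | zero => exact ⟨e, h.of_level_zero⟩
  | succ j ih =>
    obtain ⟨s, f, -, hd, -⟩ := h.of_level_succ
    exact ih hd

theorem InUnfoldingChase.hatRole_of_base {r : NR} {d e : SkolemTerm (XRole NR) NI}
    (h : InUnfoldingChase T k 𝒜 (.role (.base r) d e)) :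
    InUnfoldingChase T k 𝒜 (.role (hatRole T r) d e) := by
  unfold hatRole
  split
  · next hr =>
    obtain ⟨s, hs⟩ := hr
    obtain ⟨m, hm⟩ := h
    exact ⟨_, .rsub (Unfolding.finish hs (Nat.zero_le _)) (.rsub (Unfolding.start hs) hm)⟩
  · exact h

theorem InUnfoldingChase.exists_base_of_hatRole {r : NR} {d e : SkolemTerm (XRole NR) NI}
    (h : InUnfoldingChase T k 𝒜 (.role (hatRole T r) d e)) :
    ∃ f, InUnfoldingChase T k 𝒜 (.role (.base r) d f) := by
  unfold hatRole at h
  split at h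
  · obtain ⟨j, hj⟩ := h.of_hat
    exact hj.exists_base_of_level
  · exact ⟨e, h⟩

theorem InUnfoldingChase.smallModel_role [Nonempty NI] {r : XRole NR}
    {d e : SkolemTerm (XRole NR) NI} (h : InUnfoldingChase T k 𝒜 (.role r d e)) :
    (smallModel T 𝒜).role r.proj ((smallModel T 𝒜).extend.fromChase d)
      ((smallModel T 𝒜).extend.fromChase e) :=
  InChase.satFact (M := (smallModel T 𝒜).extend)
    (fun _ hβ => Interp.extend_satAx (fun _ => smallModel_satAx) hβ)
    (Interp.extend_satAssertion fun _ => smallModel_satAssertion) h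

/-- The order constraints bound the number of recursive steps. -/
theorem InUnfoldingChase.level_le [Nonempty NI] {C : Finset (OrdConstraint NC simple)}
    (hadm : Admissible C T 𝒜) {r : NR} {As : Finset NC} {lt : NC → NC → Prop}
    (hcov : ∀ s ∈ guards T r, ∃ c ∈ C, c.role = .name s ∧ c.concepts = As ∧ c.lt = lt)
    {s : NR} (hs : s ∈ guards T r) {j : ℕ} {d e f : SkolemTerm (XRole NR) NI}
    (hr : InUnfoldingChase T k 𝒜 (.role (.level r j) d e))
    (hse : InUnfoldingChase T k 𝒜 (.role (.base s) e f)) : j + 1 ≤ ell C := by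
  classical
  set M := smallModel T 𝒜 with hM
  set h := M.extend.fromChase with hh
  have hord : ∀ {s x y}, s ∈ guards T r → InUnfoldingChase T k 𝒜 (.role (.base s) x y) →
      (∃ A ∈ As, ∃ B ∈ As, h x ∈ M.concept A ∧ h y ∈ M.concept B) ∧
      ∀ A ∈ As, ∀ B ∈ As, h x ∈ M.concept A → h y ∈ M.concept B → lt A B := by
    intro s x y hs hxy
    obtain ⟨c, hc, hrole, rfl, rfl⟩ := hcov s hs
    have hext : M.roleExt c.role (h x) (h y) := by
      rw [hrole]
      exact hxy.smallModel_role
    refine ⟨(hadm c hc).1 _ _ hext, fun A hA B hB hx hy => ?_⟩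
    by_contra hlt
    exact (hadm c hc).2 _ _ hext ⟨A, hA, B, hB, hlt, hx, hy⟩
  obtain ⟨c, hc, -, hcA, hclt⟩ := hcov s hs
  -- The number of predecessors within `As` serves as a rank for the strict order.
  have hcount : ∀ {A B}, A ∈ As → lt A B →
      (As.filter fun D => lt D A).card < (As.filter fun D => lt D B).card := by
    intro A B hA hAB
    refine Finset.card_lt_card (Finset.ssubset_iff_of_subset ?_ |>.2 ⟨A, ?_, ?_⟩)
    · intro D hD
      rw [Finset.mem_filter] at hD ⊢
      exact ⟨hD.1, hclt ▸ c.lt_trans D A B (hclt ▸ hD.2) (hclt ▸ hAB)⟩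
    · exact Finset.mem_filter.2 ⟨hA, hAB⟩
    · exact fun hA' => c.lt_irrefl A (hclt ▸ (Finset.mem_filter.1 hA').2)
  -- The claim covers every label `A` of `e`: the label that one edge provides for its target need
  -- not be the one that the next edge provides for its source. The second half of an order
  -- constraint compares all labels, so any choice works.
  have key : ∀ {j e} {A : NC}, InUnfoldingChase T k 𝒜 (.role (.level r j) d e) → A ∈ As →
      h e ∈ M.concept A → j ≤ (As.filter fun D => lt D A).card := by
    intro j
    induction j with
    | zero => exact fun _ _ _ => Nat.zero_le _
    | succ j ih =>
      intro e A hj hA heA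
      obtain ⟨s', f', hs', hj', hfe⟩ := hj.of_level_succ
      obtain ⟨⟨B, hB, _, _, hfB, _⟩, hall⟩ := hord hs' hfe
      exact (ih hj' hB hfB).trans_lt (hcount hB (hall B hB A hA hfB heA))
  obtain ⟨⟨A, hA, B, hB, heA, hfB⟩, hall⟩ := hord hs hse
  have hlt := hcount hA (hall A hA B hB heA hfB)
  -- `B` itself is not among its predecessors, so the bound has a slack of one.
  calc j + 1 ≤ (As.filter fun D => lt D B).card := (key hr hA heA).trans_lt hlt
    _ ≤ As.card := Finset.card_filter_le _ _
    _ = c.concepts.card := by rw [hcA]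
    _ ≤ ell C := Finset.le_sup (f := fun c => c.concepts.card) hc

/-! ### The chase of the unfolding as a model of the original knowledge base -/

theorem hatRole_of_recursive {r : NR} (h : HasRecursiveCRI T r) : hatRole T r = .hat r :=
  if_pos h

theorem hatRole_of_not_recursive {r : NR} (h : ¬ HasRecursiveCRI T r) : hatRole T r = .base r :=
  if_neg h

/-- The chase of the unfolding, with `r` interpreted as `r̂` for recursive `r`. -/
def unfoldingModel [Nonempty NI] (T : Set (TAxiom NC NR)) (k : ℕ)
    (𝒜 : Set (Assertion NC NR NI)) : Interp NC NR NI where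
  dom := SkolemTerm (XRole NR) NI
  nonempty := ⟨.ind (Classical.arbitrary NI)⟩
  ind := .ind
  ind_injective := fun _ _ h => by injection h
  concept := fun A => {d | InUnfoldingChase T k 𝒜 (.concept A d)}
  role := fun r d e => InUnfoldingChase T k 𝒜 (.role (hatRole T r) d e)

/-- Other role inclusions with a recursive left-hand side hold through their copies for `r̂`, and
their conclusions pass from `r` to `r̂` through level 0. Disjointness is reflected from an arbitrary
model of `(T, 𝒜)`, into which the chase maps. Guards are simple, hence not recursive, and keep their
name. -/
theorem unfoldingModel_isModel [Nonempty NI] (hT : IsTBox simple T)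
    {C : Finset (OrdConstraint NC simple)} (hC : Covers C T) (hcons : Consistent T 𝒜)
    (hadm : Admissible C T 𝒜) : (unfoldingModel T (ell C) 𝒜).IsModel T 𝒜 := by
  obtain ⟨M, hMT, hMA⟩ := hcons
  have hsat : ∀ {f}, InUnfoldingChase T (ell C) 𝒜 f → M.extend.SatFact f :=
    InChase.satFact (fun _ hβ => Interp.extend_satAx (fun α hα _ => hMT α hα) hβ)
      (Interp.extend_satAssertion hMA)
  refine ⟨fun α hα => ?_, fun α hα => ?_⟩
  · cases α with
    | sub A A' =>
      rintro d ⟨m, hm⟩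
      exact ⟨_, .sub (Unfolding.keep hα (by simp)) hm⟩
    | subEx A p =>
      rintro d ⟨m, hm⟩
      exact ⟨.null d (.base p),
        InUnfoldingChase.hatRole_of_base ⟨_, .subEx (Unfolding.keep hα (by simp)) hm⟩⟩
    | exSub p A =>
      intro d e hde
      obtain ⟨f, m, hm⟩ := InUnfoldingChase.exists_base_of_hatRole hde
      exact ⟨_, .exSub (Unfolding.keep hα (by simp)) hm⟩
    | rsub p s =>
      intro d e hde
      -- The trivial inclusion `p ⊑ p` has no copy for the hatted name and needs none.
      by_cases hsp : s = p
      · exact hsp ▸ hde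
      · apply InUnfoldingChase.hatRole_of_base
        obtain ⟨m, hm⟩ := hde
        by_cases hp : HasRecursiveCRI T p
        · rw [hatRole_of_recursive hp] at hm
          exact ⟨_, .rsub (Unfolding.rsub_hat hp hα hsp) hm⟩
        · rw [hatRole_of_not_recursive hp] at hm
          exact ⟨_, .rsub (Unfolding.keep hα (by simp)) hm⟩
    | rsubInv p s =>
      intro d e hde
      apply InUnfoldingChase.hatRole_of_base
      obtain ⟨m, hm⟩ := hde
      by_cases hp : HasRecursiveCRI T p
      · rw [hatRole_of_recursive hp] at hm
        exact ⟨_, .rsubInv (Unfolding.rsubInv_hat hp hα) hm⟩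
      · rw [hatRole_of_not_recursive hp] at hm
        exact ⟨_, .rsubInv (Unfolding.keep hα (by simp)) hm⟩
    | disjC A A' =>
      rintro d ⟨h₁, h₂⟩
      exact hMT _ hα _ ⟨hsat h₁, hsat h₂⟩
    | disjR p p' =>
      rintro d e ⟨h₁, h₂⟩
      have h₁ := hsat h₁
      have h₂ := hsat h₂
      simp only [Interp.SatFact, Interp.extend, hatRole_proj] at h₁ h₂
      exact hMT _ hα _ _ ⟨h₁, h₂⟩
    | cri r s t =>
      intro d₁ d₂ d₃ h₁ h₂
      change InUnfoldingChase T (ell C) 𝒜 (.role (hatRole T s) d₂ d₃) at h₂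
      change InUnfoldingChase T (ell C) 𝒜 (.role (hatRole T r) d₁ d₂) at h₁
      rw [hatRole_of_mem_simple hT (hT.cri_guard _ _ _ hα)] at h₂
      by_cases htr : t = r
      · subst htr
        have ht : HasRecursiveCRI T t := ⟨s, hα⟩
        rw [hatRole_of_recursive ht] at h₁
        obtain ⟨j, hj⟩ := h₁.of_hat
        obtain ⟨As, lt, hcov⟩ := hC t
        -- The composition lands in level `j + 1`, which the unfolding still has and still exports
        -- to the hatted role.
        have hle := InUnfoldingChase.level_le hadm hcov hα hj h₂
        change InUnfoldingChase T (ell C) 𝒜 (.role (hatRole T t) d₁ d₃)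
        rw [hatRole_of_recursive ht]
        obtain ⟨m₁, hm₁⟩ := hj
        obtain ⟨m₂, hm₂⟩ := h₂
        exact ⟨_, .rsub (Unfolding.finish hα hle) (.cri (Unfolding.next hα hle) hm₁ hm₂)⟩
      · apply InUnfoldingChase.hatRole_of_base
        obtain ⟨m₁, hm₁⟩ := h₁
        obtain ⟨m₂, hm₂⟩ := h₂
        by_cases hr : HasRecursiveCRI T r
        · rw [hatRole_of_recursive hr] at hm₁
          exact ⟨_, .cri (Unfolding.cri_hat hr hα htr) hm₁ hm₂⟩
        · rw [hatRole_of_not_recursive hr] at hm₁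
          refine ⟨_, .cri (Unfolding.keep hα ?_) hm₁ hm₂⟩
          intro r' s' h
          injection h with h₁ _ h₃
          exact htr (h₃.trans h₁.symm)
  · cases α with
    | concept A a => exact ⟨0, .concept ⟨_, hα, rfl⟩⟩
    | role p a b => exact InUnfoldingChase.hatRole_of_base ⟨0, .role ⟨_, hα, rfl⟩⟩

theorem hatQuery_matches_of_isAnswer [Nonempty NI] {q : CQ NC NR NI V n} {a : Fin n → NI}
    (h : (unfoldingModel T k 𝒜).IsAnswer q fun i => (unfoldingModel T k 𝒜).ind (a i)) :
    ∃ π, (hatQuery T q).Matches {α | Unfolding T k α} (liftABox 𝒜) π a := by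
  obtain ⟨π, hπ, hat⟩ := h
  refine ⟨π, hπ, fun β hβ => ?_⟩
  simp only [hatQuery, Finset.mem_image] at hβ
  obtain ⟨α, hα, rfl⟩ := hβ
  have h := hat α hα
  cases α with
  | concept => exact h
  | role => exact h
  | eq t t' => cases t <;> cases t' <;> exact h

theorem ind_liftABox : ind (liftABox 𝒜) = ind 𝒜 := by
  have key : ∀ α : Assertion NC NR NI, (α.mapR XRole.base).inds = α.inds := by
    rintro (_ | _) <;> rfl
  ext a
  simp [ind, liftABox, key]

/-- Individuals map to their interpretations, a homomorphism from the ABox. Hence a single disjunct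
that matches the ABox serves all models at once. -/
theorem Interp.IsAnswer.of_aboxInterp [Nonempty NI] {q : CQ NC NR NI V n} {a : Fin n → NI}
    (h : (aboxInterp 𝒜).IsAnswer q a) {M : Interp NC NR NI} (hM : ∀ α ∈ 𝒜, M.SatAssertion α) :
    M.IsAnswer q fun i => M.ind (a i) := by
  obtain ⟨π, hπ, hat⟩ := h
  refine ⟨fun x => M.ind (π x), fun i => congrArg M.ind (hπ i), fun α hα => ?_⟩
  have h := hat α hα
  cases α with
  | concept => exact hM _ h
  | role => exact hM _ h
  | eq t t' => cases t <;> cases t' <;> exact congrArg M.ind h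

end Unfold

end DLLite

theorem mainTheorem5 {NC NR NI V : Type} [Nonempty NI]
    (simple : Set NR) (T : Set (DLLite.TAxiom NC NR))
    (hT : DLLite.IsTBox simple T) (hsafe : DLLite.RecursionSafe simple T)
    (C : Finset (DLLite.OrdConstraint NC simple)) (hC : DLLite.Covers C T)
    {n : ℕ} (q : DLLite.CQ NC NR NI V n)
    (z : DLLite.CQ NC (DLLite.XRole NR) NI V n → V) (hz : ∀ p, z p ∉ p.vars)
    (𝒜 : Set (DLLite.Assertion NC NR NI)) (h𝒜 : 𝒜.Finite)
    (hcons : DLLite.Consistent T 𝒜) (hadm : DLLite.Admissible C T 𝒜) :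
    DLLite.cert {q} T 𝒜 =
      DLLite.cert (DLLite.kRewriting z T (DLLite.ell C) q) ∅ (DLLite.liftABox 𝒜) := by
  open DLLite in
  ext a
  refine ⟨fun ⟨hind, h⟩ => ⟨fun i => ind_liftABox.symm ▸ hind i, fun I hI => ?_⟩,
    fun ⟨hind, h⟩ => ⟨fun i => ind_liftABox ▸ hind i, fun M hM => ⟨q, rfl, ?_⟩⟩⟩
  · obtain ⟨q', rfl, hq⟩ := h _ (unfoldingModel_isModel hT hC hcons hadm)
    obtain ⟨π, hπ⟩ := hatQuery_matches_of_isAnswer hq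
    obtain ⟨p, hp, ha⟩ := hπ.exists_mem_rew hz
    exact ⟨p, hp, ha.of_aboxInterp hI.2⟩
  · obtain ⟨p, hp, ha⟩ := h M.extend ⟨fun _ h => h.elim, Interp.extend_satAssertion hM.2⟩
    exact Interp.extend_isAnswer_hatQuery (isAnswer_of_mem_rew hp
      (fun _ hβ => Interp.extend_satAx (fun α hα _ => hM.1 α hα) hβ) ha)
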